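/- **Setting.** Errors are Pauli errors, tracked separately as $X$ and $Z$ parts. The code is the $[[23,1,7]]$ Golay code (a self-dual CSS code); $D(e)\in\{0,1\}$ tells whether an $X$ (or $Z$) error $e$ on a block is correctable ($0$, i.e. of weight at most $3$ up to stabilizers) or decodes to a logical error ($1$). *Circuits.* Fix four circuits that prepare encoded $|0\rangle$ (qubits prepared in $|0\rangle,|+\rangle$, CNOT gates, rests). A verified $|0\rangle$ is obtained from four so prepared ancillas: in each of two pairs the first is checked for $X$ errors against the second (transversal CNOT from first to second, $Z$-basis measurement of the second, accept iff the error seen is a stabilizer), then, after transversal rests, the remaining ancilla of the first pair is checked for $Z$ errors against that of the second (transversal CNOT from the second to the first, $X$-basis measurement of the second, accept iff the syndrome vanishes). A verified $|+\rangle$ is prepared by the dual circuit. Assume that the verified ancilla is strictly fault-tolerant: for $k\le 3$, any $k$ failures that pass verification lead to an error of weight at most $k$ (up to stabilizers of the prepared state). Error correction is Steane's: $Z$ errors first (rests on a verified $|0\rangle$, transversal CNOT from it to the data, $X$-basis measurement), then $X$ errors (dually, with a verified $|+\rangle$); lowest-weight corrections are applied noiselessly in the Pauli frame. The extended rectangle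 (exRec) of a gate consists of a leading error correction on each input block, the transversal gate, and a trailing error correction on each output block (a preparation consists of the verified ancilla, a transversal rest and the trailing correction; a measurement has no trailing correction). It is partial if some trailing corrections are removed. For $E$ among the twelve events $IX,XI,XX,IZ,ZI,ZZ$ (CNOT), and $X,Z$ for preparation, for measurement and for rest (preparation of $|0\rangle$ and $Z$-basis measurement for $X$, preparation of $|+\rangle$ and $X$-basis measurement for $Z$), $\mathrm{mal}_E$ is the event that the decoded $X$ (resp. $Z$) error at the output equals the ideal gate applied to the decoded error after the leading corrections, times $E$. *Noise.* A level-zero location of depolarizing noise with parameter $\gamma\le 1/15$ suffers each of the $15$ nontrivial two-qubit Pauli errors with probability $\gamma$ after a CNOT; $X$, $Y$, $Z$ with probability $4\gamma$ each at a rest; an $X$ error with probability $4\gamma$ after preparing $|0\rangle$ or before a $Z$-basis measurement, and a $Z$ error with probability $4\gamma$ after preparing $|+\rangle$ or before an $X$-basis measurement. A level-$(k+1)$ location is a rectangle that is replaced by its gate followed by the logical error of its full or any partial exRec, where the locations of the exRec are independent level-$k$ locations and all events are conditioned on the acceptance of all verifications. $\Pr[\mathrm{mal}_E^{(k)}]$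 is the probability of $E$ for a level-$k$ location; bounds on it are required, or claimed, for the full and all partial exRecs at every level. The *noise threshold* is the largest $g\le 1/15$ such that for every $\gamma\in[0,g)$ and every circuit of preparations, CNOT gates, rests and measurements, the probability that all level-$k$ rectangles of its simulation are correct tends to $1$ as $k\to\infty$ (uniformly over the choices of full or partial exRecs). *Bounds.* Let $0\le\gamma_{\max}\le 1/15$, let $\mathcal P^{(1)}_E$ and $\Gamma^{(1)}$ be functions on $[0,\gamma_{\max}]$ and $\alpha_E>0$ constants with $$\Pr[\mathrm{mal}^{(1)}_E]\le \mathcal P^{(1)}_E(\gamma)\le\alpha_E\Gamma^{(1)}(\gamma)\qquad(0\le\gamma\le\gamma_{\max})$$ for all twelve $E$, with $\Gamma^{(1)}$ strictly increasing (e.g. a non-constant monotone polynomial). For $t\ge0$ let $\mathcal P^{(2)}_E(t)$ be the bound obtained by counting with the weights $\alpha_E t$: for a location, the error $E$ has weight $\alpha_E t$ and no failure has weight $1$; the weight of a configuration of $X$ (or of $Z$) errors is the product over the locations; then $\mathcal P_E^{(2)}$ is the maximum over the full and partial exRecs of $$\frac{\sum_{\text{good, accepted configurations in }\mathrm{mal}_E}\text{weight}}{\prod_{\text{ancillas}}A}+\sum_{\text{bad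 events }B}\frac{\prod_{(C,c)\in B}e_{c+1}(C)}{\prod_{\text{ancillas meeting }B}A}.$$ Here finitely many bad events are chosen freely, each being of the form "for each $(C,c)\in B$ more than $c$ locations of $C$ fail" with disjoint sets $C$, and requiring at least $\mathrm{ord}(B)=\sum_{(C,c)\in B}(c+1)\ge2$ failures; a configuration is good if no bad event occurs; $e_{j}(C)$ is the sum over the $j$-element subsets of $C$ of the products of the total failure weights; accepted refers to the checks for the type of errors of $E$ only. $A=A_1A_1'A_2$ is a lower bound on the acceptance probability of an ancilla: $A_1,A_1'$ equal $1$ minus the total weight of the good rejected configurations of the first check of the respective pair minus the bounds $\prod e_{c+1}(C)$ of its bad events, and $A_2$ equals $1$ minus the same quantity for the second check divided by $A_1A_1'$ (bad events for the checks being chosen freely as well). **Theorem.** Let $\gamma_{\rm th}\in[0,\gamma_{\max}]$ be such that the acceptance bounds $A_1,A_1',A_2$ are positive at $t=\Gamma^{(1)}(\gamma_{\rm th})$ (for $|0\rangle$ and $|+\rangle$), and $$\mathcal P^{(2)}_E(\Gamma^{(1)}(\gamma_{\rm th}))\le\alpha_E\Gamma^{(1)}(\gamma_{\rm th})\quad\text{for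 all twelve events }E$$ (for instance the largest such value). Then the noise threshold is at least $\gamma_{\rm th}$. Moreover, for every $\gamma\in[0,\gamma_{\rm th})$ there is $\epsilon\in(0,1)$ such that $$\Pr[\mathrm{mal}_E^{(k+1)}]\le\epsilon^{4k-3}\alpha_E\Gamma^{(1)}(\gamma)\quad\text{for all }k\ge1\text{ and all }E.\qquad(*)$$ If all bad events of exRecs have $\mathrm{ord}(B)\ge4$, then $(*)$ holds for every $\epsilon\in[0,1]$ such that $\mathcal P^{(2)}_E(\Gamma^{(1)}(\gamma))\le\epsilon\,\alpha_E\Gamma^{(1)}(\gamma)$ for all $E$. -/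

import Mathlib

namespace GolayFT

open scoped Classical

/-! ### The Golay code

Errors are tracked as bit vectors: an `X` error (resp. `Z` error) on a 23-qubit block is the
vector of the qubits on which it acts. -/

/-- An `X` error, or a `Z` error, on a 23-qubit block. -/
abbrev Blk := Fin 23 → ZMod 2

/-- The eleven weight-eight stabilizer generators (the same for `X` and for `Z`). -/
def golayGen : Fin 11 → Blk :=
  ![![0,1,0,0,1,0,0,1,1,1,1,1,0,0,0,0,0,0,0,0,0,0,1],
    ![1,0,0,1,0,0,1,1,1,1,1,0,0,0,0,0,0,0,0,0,0,1,0],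
    ![0,1,1,0,1,1,1,0,0,0,1,1,0,0,0,0,0,0,0,0,1,0,0],
    ![1,1,0,1,1,1,0,0,0,1,1,0,0,0,0,0,0,0,0,1,0,0,0],
    ![1,1,1,1,0,0,0,1,0,0,1,1,0,0,0,0,0,0,1,0,0,0,0],
    ![1,0,1,0,1,0,1,1,1,0,0,1,0,0,0,0,0,1,0,0,0,0,0],
    ![0,0,0,1,1,1,1,0,1,1,0,1,0,0,0,0,1,0,0,0,0,0,0],
    ![0,0,1,1,1,1,0,1,1,0,1,0,0,0,0,1,0,0,0,0,0,0,0],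
    ![0,1,1,1,1,0,1,1,0,1,0,0,0,0,1,0,0,0,0,0,0,0,0],
    ![1,1,1,1,0,1,1,0,1,0,0,0,0,1,0,0,0,0,0,0,0,0,0],
    ![1,0,1,0,0,1,0,0,1,1,1,1,1,0,0,0,0,0,0,0,0,0,0]]

/-- The errors that are products of stabilizers, i.e. the trivial errors. -/
def stab : Submodule (ZMod 2) Blk := Submodule.span (ZMod 2) (Set.range golayGen)

/-- The errors with trivial syndrome: stabilizers and logical operators. -/
def code : Set Blk := {v | ∀ i, golayGen i ⬝ᵥ v = 0}

/-- An error is correctable if, up to stabilizers, its weight is at most three. -/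
def Correctable (e : Blk) : Prop := ∃ s ∈ stab, hammingNorm (e + s) ≤ 3

/-- The ideal decoder: `0` on correctable errors, `1` on uncorrectable ones, which decode to
a logical error. -/
noncomputable def D (e : Blk) : ZMod 2 := if Correctable e then 0 else 1

/-- The lowest-weight correction for the syndrome of `e`. The code is perfect: every syndrome
is that of exactly one error of weight at most three. -/
noncomputable def corr (e : Blk) : Blk :=
  if h : ∃ w : Blk, hammingNorm w ≤ 3 ∧ e + w ∈ code then h.choose else 0

/-! ### Error types, locations, malignant events -/

/-- `X` errors or `Z` errors. -/
inductive Axis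
  | X
  | Z
  deriving DecidableEq

instance : Fintype Axis := ⟨{.X, .Z}, fun a => by cases a <;> simp⟩

/-- The other type of error. -/
def Axis.other : Axis → Axis
  | .X => .Z
  | .Z => .X

/-- The `X` part, or the `Z` part, of the error of a location. For a CNOT gate the entries
belong to the control and the target; a one-qubit location uses the first entry only. -/
abbrev Part := ZMod 2 × ZMod 2

/-- A Pauli error at a location: its `X` part and its `Z` part. -/
abbrev Err := Axis → Part

/-- The kinds of locations. `prep .X` prepares `|0⟩` (which an `X` error spoils), `prep .Z`
prepares `|+⟩`; `meas .X` measures in the `Z` basis (which an `X` error spoils), `meas .Z`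
measures in the `X` basis. -/
inductive Kind
  | cnot
  | rest
  | prep (b : Axis)
  | meas (b : Axis)
  deriving DecidableEq

/-- The twelve malignant events. -/
inductive Mal
  | IX | XI | XX | IZ | ZI | ZZ
  | prepX | prepZ | measX | measZ | restX | restZ
  deriving DecidableEq

instance : Fintype Mal :=
  ⟨{.IX, .XI, .XX, .IZ, .ZI, .ZZ, .prepX, .prepZ, .measX, .measZ, .restX, .restZ},
    fun E => by cases E <;> simp⟩

/-- The kind of rectangle an event belongs to. -/
def Mal.kind : Mal → Kind
  | .IX | .XI | .XX | .IZ | .ZI | .ZZ => .cnot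
  | .prepX => .prep .X
  | .prepZ => .prep .Z
  | .measX => .meas .X
  | .measZ => .meas .Z
  | .restX | .restZ => .rest

/-- Whether an event concerns `X` or `Z` errors. -/
def Mal.axis : Mal → Axis
  | .IX | .XI | .XX | .prepX | .measX | .restX => .X
  | .IZ | .ZI | .ZZ | .prepZ | .measZ | .restZ => .Z

/-- The logical error that an event introduces. -/
def Mal.err : Mal → Part
  | .IX | .IZ => (0, 1)
  | .XX | .ZZ => (1, 1)
  | _ => (1, 0)

/-- A location of kind `κ` can produce the error `p` of type `a`. -/
def CanErr (a : Axis) (κ : Kind) (p : Part) : Prop :=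
  p = 0 ∨ ∃ E : Mal, E.kind = κ ∧ E.axis = a ∧ E.err = p

/-- Sum over the configurations `f` of a finite set of locations that satisfy `A` of the product
over the locations of `w ℓ (f ℓ)`. If the `w ℓ` are probability vectors, this is the probability
of `A` when the locations fail independently. -/
noncomputable def cfgSum {L β : Type} [Fintype L] [Fintype β] (w : L → β → ℝ)
    (A : (L → β) → Prop) : ℝ :=
  ∑ f : L → β, if A f then ∏ ℓ, w ℓ (f ℓ) else 0

/-- Independent depolarizing noise with parameter `γ`: the law of the error of a location. -/
noncomputable def depol (γ : ℝ) : Kind → Err → ℝ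
  | .cnot, e => if e = 0 then 1 - 15 * γ else γ
  | .rest, e => if e = 0 then 1 - 12 * γ else if ∀ a, (e a).2 = 0 then 4 * γ else 0
  | .prep b, e => if e = 0 then 1 - 4 * γ else if e = Pi.single b (1, 0) then 4 * γ else 0
  | .meas b, e => if e = 0 then 1 - 4 * γ else if e = Pi.single b (1, 0) then 4 * γ else 0

/-- How a CNOT gate propagates errors: `X` errors from control to target, `Z` errors from target
to control. -/
def cnotProp {M : Type} [Add M] : Axis → M × M → M × M
  | .X, (u, v) => (u, u + v)
  | .Z, (u, v) => (u + v, v)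

/-! ### Preparation circuits for encoded `|0⟩` -/

/-- A gate of a preparation circuit. -/
inductive PGate
  | cnot (i j : Fin 23) (h : i ≠ j)
  | rest (i : Fin 23)

/-- A preparation circuit: each of the 23 qubits is prepared in `|+⟩` (if `plus`) or `|0⟩`, then
CNOT gates and rests are applied in order. -/
structure PrepCircuit where
  plus : Fin 23 → Bool
  gates : List PGate

/-- Effect of one gate with error `p` on the current error `v` of type `a`. -/
def PGate.step (a : Axis) (v : Blk) : PGate → Part → Blk
  | .cnot i j _, p =>
      let w := cnotProp a (v i, v j)
      Function.update (Function.update v i (w.1 + p.1)) j (w.2 + p.2)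
  | .rest i, p => Function.update v i (v i + p.1)

/-- The error of type `a` at the output of a preparation circuit, from the errors `p` of the
qubit preparations and `g` of the gates. -/
def PrepCircuit.out (c : PrepCircuit) (a : Axis) (p : Blk) (g : Fin c.gates.length → Part) : Blk :=
  (List.finRange c.gates.length).foldl (fun v n => (c.gates.get n).step a v (g n)) p

/-- The circuit prepares encoded `|0⟩`: the `X` stabilizers of the qubits prepared in `|+⟩` are
propagated to generators of the `X` stabilizers of the code. -/
def PrepCircuit.Encodes (c : PrepCircuit) : Prop :=
  Submodule.span (ZMod 2) {v | ∃ i, c.plus i = true ∧ v = c.out .X (Pi.single i 1) 0} = stab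

/-- The four preparation circuits used to prepare one verified ancilla. -/
abbrev Scheme := Fin 4 → PrepCircuit

/-! ### Verified ancillas

Ancillas `0, 1` and ancillas `2, 3` form two pairs `s = 0, 1`. In each pair the first ancilla is
checked for `X` errors: transversal CNOT from the first to the second, `Z`-basis measurement of
the second. After a pause (rests), the first ancilla of pair `0` is checked for `Z` errors:
transversal CNOT from the first ancilla of pair `1` to it, `X`-basis measurement of the former.

The encoded `|+⟩` is prepared by the dual circuit: `|0⟩` and `|+⟩`, `X` and `Z`, and control and
target of each CNOT are exchanged. An ancilla has type `.X` if it is an encoded `|0⟩` (checked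
first for `X` errors) and type `.Z` if it is an encoded `|+⟩`. -/

/-- The locations of a verified ancilla. -/
abbrev AncLoc (S : Scheme) : Type :=
  (Fin 4 × Fin 23) ⊕ (Σ i : Fin 4, Fin (S i).gates.length) ⊕ (Fin 2 × Fin 23) ⊕
    (Fin 2 × Fin 23) ⊕ (Fin 2 × Fin 23) ⊕ Fin 23 ⊕ Fin 23

namespace AncLoc
variable {S : Scheme}

/-- Preparation of qubit `q` of ancilla `i`. -/
@[reducible] def prep (i : Fin 4) (q : Fin 23) : AncLoc S := .inl (i, q)
/-- Gate `n` of preparation circuit `i`. -/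
@[reducible] def gate (i : Fin 4) (n : Fin (S i).gates.length) : AncLoc S := .inr (.inl ⟨i, n⟩)
/-- CNOT of the first check, pair `s`. -/
@[reducible] def cnot₁ (s : Fin 2) (q : Fin 23) : AncLoc S := .inr (.inr (.inl (s, q)))
/-- Measurement of the first check, pair `s`. -/
@[reducible] def meas₁ (s : Fin 2) (q : Fin 23) : AncLoc S := .inr (.inr (.inr (.inl (s, q))))
/-- Rest of the remaining ancilla of pair `s`. -/
@[reducible] def pause (s : Fin 2) (q : Fin 23) : AncLoc S :=
  .inr (.inr (.inr (.inr (.inl (s, q)))))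
/-- CNOT of the second check. -/
@[reducible] def cnot₂ (q : Fin 23) : AncLoc S := .inr (.inr (.inr (.inr (.inr (.inl q)))))
/-- Measurement of the second check. -/
@[reducible] def meas₂ (q : Fin 23) : AncLoc S := .inr (.inr (.inr (.inr (.inr (.inr q)))))

/-- The kind of a location of an ancilla of type `b`. -/
def kind (b : Axis) : AncLoc S → Kind
  | .inl (i, q) => .prep (if (S i).plus q then b.other else b)
  | .inr (.inl ⟨i, n⟩) =>
      match (S i).gates.get n with
      | .cnot _ _ _ => .cnot
      | .rest _ => .rest
  | .inr (.inr (.inl _)) => .cnot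
  | .inr (.inr (.inr (.inl _))) => .meas b
  | .inr (.inr (.inr (.inr (.inl _)))) => .rest
  | .inr (.inr (.inr (.inr (.inr (.inl _))))) => .cnot
  | .inr (.inr (.inr (.inr (.inr (.inr _))))) => .meas b.other

/-- The locations of the first check of pair `s`: its two preparations, its CNOT gates and its
measurements. -/
def pairLocs (s : Fin 2) : AncLoc S → Prop
  | .inl (i, _) => i.val / 2 = s.val
  | .inr (.inl ⟨i, _⟩) => i.val / 2 = s.val
  | .inr (.inr (.inl (s', _))) => s' = s
  | .inr (.inr (.inr (.inl (s', _)))) => s' = s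
  | _ => False

end AncLoc

section Ancilla
variable {S : Scheme}

/-- Error of type `a` at the output of preparation circuit `i`, encoded `|0⟩` case. -/
def prepOut (a : Axis) (f : AncLoc S → Part) (i : Fin 4) : Blk :=
  (S i).out a (fun q => (f (.prep i q)).1) (fun n => f (.gate i n))

/-- The first ancilla of pair `s`, which is kept. -/
def fst (s : Fin 2) : Fin 4 := ⟨2 * s.val, by omega⟩
/-- The second ancilla of pair `s`, which is measured. -/
def snd (s : Fin 2) : Fin 4 := ⟨2 * s.val + 1, by omega⟩

/-- Error of type `a` on the remaining ancilla of pair `s` after the first check and the pause. -/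
def pairOut (a : Axis) (f : AncLoc S → Part) (s : Fin 2) : Blk := fun q =>
  (cnotProp a (prepOut a f (fst s) q, prepOut a f (snd s) q)).1 + (f (.cnot₁ s q)).1
    + (f (.pause s q)).1

/-- `X` error seen by the first check of pair `s`. -/
def check₁ (f : AncLoc S → Part) (s : Fin 2) : Blk := fun q =>
  prepOut .X f (fst s) q + prepOut .X f (snd s) q + (f (.cnot₁ s q)).2 + (f (.meas₁ s q)).1

/-- `Z` error seen by the second check. -/
def check₂ (f : AncLoc S → Part) : Blk := fun q =>
  pairOut .Z f 1 q + pairOut .Z f 0 q + (f (.cnot₂ q)).1 + (f (.meas₂ q)).1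

/-- Error of type `a` on the verified encoded `|0⟩`. -/
def zeroOut (a : Axis) (f : AncLoc S → Part) : Blk := fun q =>
  (cnotProp a (pairOut a f 1 q, pairOut a f 0 q)).2 + (f (.cnot₂ q)).2

/-- Acceptance of the checks of errors of type `a` for the encoded `|0⟩`. An `X` error is detected
unless it is a stabilizer; the second check detects `Z` errors with nontrivial syndrome (logical
`Z` is trivial on `|0⟩`). -/
def zeroAcc (a : Axis) (f : AncLoc S → Part) : Prop :=
  match a with
  | .X => ∀ s, check₁ f s ∈ stab
  | .Z => check₂ f ∈ code

/-- Part of the errors of an ancilla of type `b`, seen in the encoded `|0⟩` circuit: for `|+⟩` control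
and target of the CNOT gates are exchanged. -/
def orient (b : Axis) (f : AncLoc S → Part) : AncLoc S → Part := fun ℓ =>
  if b = .Z ∧ ℓ.kind b = .cnot then (f ℓ).swap else f ℓ

/-- The role that errors of type `a` play in an ancilla of type `b`. -/
def role : Axis → Axis → Axis
  | .X, a => a
  | .Z, a => a.other

/-- Error of type `a` on a verified ancilla of type `b`. -/
def ancOut (b a : Axis) (f : AncLoc S → Part) : Blk := zeroOut (role b a) (orient b f)

/-- Acceptance of the checks of errors of type `a` of an ancilla of type `b`. -/
def ancAcc (b a : Axis) (f : AncLoc S → Part) : Prop := zeroAcc (role b a) (orient b f)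

end Ancilla

/-- Number of failures in a configuration. -/
noncomputable def numFail {L : Type} [Fintype L] (f : L → Part) : ℕ :=
  (Finset.univ.filter fun ℓ => f ℓ ≠ 0).card

/-- Strict fault tolerance of the verified encoded `|0⟩` (the distance is 7): for `k ≤ 3`, any `k`
failures that pass verification lead to an error of weight at most `k`, up to the stabilizers
of encoded `|0⟩` (for `Z` errors these include logical `Z`). -/
def StrictlyFaultTolerant (S : Scheme) : Prop :=
  (∀ f : AncLoc S → Part, (∀ ℓ, CanErr .X (ℓ.kind .X) (f ℓ)) → zeroAcc .X f → numFail f ≤ 3 →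
    ∃ s ∈ stab, hammingNorm (zeroOut .X f + s) ≤ numFail f) ∧
  (∀ f : AncLoc S → Part, (∀ ℓ, CanErr .Z (ℓ.kind .X) (f ℓ)) → zeroAcc .Z f → numFail f ≤ 3 →
    ∃ s ∈ code, hammingNorm (zeroOut .Z f + s) ≤ numFail f)

/-! ### Error correction

`Z`-error correction with a verified `|0⟩` (type `.X`): pause of the ancilla, transversal CNOT from
the ancilla to the data, `X`-basis measurement. Then `X`-error correction with a verified `|+⟩`
(type `.Z`): pause, transversal CNOT from the data to the ancilla, `Z`-basis measurement. Corrections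
are applied in the Pauli frame, without noise. -/

/-- The locations of an error correction: for each of the two ancillas those of its preparation
and verification, the pause, the CNOT gates and the measurements. -/
abbrev ECLoc (S : Scheme) : Type :=
  (Axis × AncLoc S) ⊕ (Axis × Fin 23) ⊕ (Axis × Fin 23) ⊕ (Axis × Fin 23)

namespace ECLoc
variable {S : Scheme}

/-- Location of the ancilla of type `b`. -/
@[reducible] def anc (b : Axis) (ℓ : AncLoc S) : ECLoc S := .inl (b, ℓ)
/-- Rest of the verified ancilla of type `b`. -/
@[reducible] def pause (b : Axis) (q : Fin 23) : ECLoc S := .inr (.inl (b, q))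
/-- CNOT between data and ancilla of type `b`. -/
@[reducible] def cnot (b : Axis) (q : Fin 23) : ECLoc S := .inr (.inr (.inl (b, q)))
/-- Measurement of the ancilla of type `b`. -/
@[reducible] def meas (b : Axis) (q : Fin 23) : ECLoc S := .inr (.inr (.inr (b, q)))

/-- The kind of a location of an error correction. -/
def kind : ECLoc S → Kind
  | .inl (b, ℓ) => ℓ.kind b
  | .inr (.inl _) => .rest
  | .inr (.inr (.inl _)) => .cnot
  | .inr (.inr (.inr (b, _))) => .meas b.other

end ECLoc

section ExRec
variable {S : Scheme}

/-- Error of type `a` at the output of an error correction with input error `e`. -/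
noncomputable def ecOut (a : Axis) (e : Blk) (f : ECLoc S → Part) : Blk :=
  let anc : Axis → Blk := fun b q => ancOut b a (fun ℓ => f (.anc b ℓ)) q + (f (.pause b q)).1
  -- control: the encoded `|0⟩`, target: the data
  let c₁ : Fin 23 → ZMod 2 × ZMod 2 := fun q =>
    cnotProp a (anc .X q, e q) + f (.cnot .X q)
  let d₁ : Blk := fun q => (c₁ q).2
  let m₁ : Blk := fun q => (c₁ q).1 + (f (.meas .X q)).1
  let d₁' : Blk := if a = .Z then d₁ + corr m₁ else d₁
  -- control: the data, target: the encoded `|+⟩`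
  let c₂ : Fin 23 → ZMod 2 × ZMod 2 := fun q =>
    cnotProp a (d₁' q, anc .Z q) + f (.cnot .Z q)
  let d₂ : Blk := fun q => (c₂ q).1
  let m₂ : Blk := fun q => (c₂ q).2 + (f (.meas .Z q)).1
  if a = .X then d₂ + corr m₂ else d₂

/-! ### Extended rectangles -/

/-- The locations that an extended rectangle can have: leading error corrections on the blocks
`0, 1`, the transversal gate, trailing error corrections on the blocks `0, 1`, and, for encoded
preparations, the verified ancilla and its pause. Which of them are present is told by `kindAt`. -/
abbrev ExLoc (S : Scheme) : Type :=
  (Fin 2 × ECLoc S) ⊕ Fin 23 ⊕ (Fin 2 × ECLoc S) ⊕ AncLoc S ⊕ Fin 23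

namespace ExLoc

/-- Leading error correction on block `i`. -/
@[reducible] def lec (i : Fin 2) (ℓ : ECLoc S) : ExLoc S := .inl (i, ℓ)
/-- Transversal gate. -/
@[reducible] def gate (q : Fin 23) : ExLoc S := .inr (.inl q)
/-- Trailing error correction on block `i`. -/
@[reducible] def tec (i : Fin 2) (ℓ : ECLoc S) : ExLoc S := .inr (.inr (.inl (i, ℓ)))
/-- Verified ancilla of an encoded preparation. -/
@[reducible] def anc (ℓ : AncLoc S) : ExLoc S := .inr (.inr (.inr (.inl ℓ)))
/-- Pause after the verification of an encoded preparation. -/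
@[reducible] def pause (q : Fin 23) : ExLoc S := .inr (.inr (.inr (.inr q)))

end ExLoc

/-- A variant of an extended rectangle: which trailing error corrections are kept. The full
extended rectangle keeps all; the partial ones arise when the following rectangle is incorrect. -/
abbrev Variant := Fin 2 → Bool

/-- The leading error correction on block `i` is present. -/
def lecOn : Kind → Fin 2 → Bool
  | .cnot, _ => true
  | .rest, i => i = 0
  | .prep _, _ => false
  | .meas _, i => i = 0

/-- The trailing error correction on block `i` is present. -/
def tecOn : Kind → Variant → Fin 2 → Bool
  | .cnot, v, i => v i
  | .rest, v, i => i = 0 && v i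
  | .prep _, v, i => i = 0 && v i
  | .meas _, _, _ => false

/-- The kind of a location of the extended rectangle for a gate of kind `κ`; `none` if the
location is not present. -/
def kindAt (κ : Kind) (v : Variant) : ExLoc S → Option Kind
  | .inl (i, ℓ) => if lecOn κ i then some ℓ.kind else none
  | .inr (.inl _) =>
      match κ with
      | .prep _ => none
      | κ => some κ
  | .inr (.inr (.inl (i, ℓ))) => if tecOn κ v i then some ℓ.kind else none
  | .inr (.inr (.inr (.inl ℓ))) =>
      match κ with
      | .prep b => some (ℓ.kind b)
      | _ => none
  | .inr (.inr (.inr (.inr _))) =>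
      match κ with
      | .prep _ => some .rest
      | _ => none

/-- Error at the output of the leading error correction on block `i` (trivial input error: the
output syndrome does not depend on the input). -/
noncomputable def lecOut (a : Axis) (f : ExLoc S → Part) (i : Fin 2) : Blk :=
  ecOut a 0 (fun ℓ => f (.lec i ℓ))

/-- Error after the trailing error correction on block `i`, if it is present. -/
noncomputable def tecOut (κ : Kind) (v : Variant) (a : Axis) (f : ExLoc S → Part) (i : Fin 2)
    (e : Blk) : Blk :=
  if tecOn κ v i then ecOut a e (fun ℓ => f (.tec i ℓ)) else e

/-- The logical error of type `a` introduced by the rectangle: the decoded error at the output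
minus the ideal gate applied to the decoded error after the leading error corrections. A logical `Z`
error on a prepared `|0⟩` or before a `Z`-basis measurement is immaterial, and dually. -/
noncomputable def logical (κ : Kind) (v : Variant) (a : Axis) (f : ExLoc S → Part) : Part :=
  match κ with
  | .cnot =>
      let u := (lecOut a f 0, lecOut a f 1)
      let w := cnotProp a u
      let o := (D (tecOut .cnot v a f 0 (w.1 + fun q => (f (.gate q)).1)),
        D (tecOut .cnot v a f 1 (w.2 + fun q => (f (.gate q)).2)))
      o - cnotProp a (D u.1, D u.2)
  | .rest =>
      let u := lecOut a f 0
      (D (tecOut .rest v a f 0 (u + fun q => (f (.gate q)).1)) - D u, 0)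
  | .prep b =>
      if a = b then
        (D (tecOut (.prep b) v a f 0
          (ancOut b a (fun ℓ => f (.anc ℓ)) + fun q => (f (.pause q)).1)), 0)
      else 0
  | .meas b =>
      if a = b then
        let u := lecOut a f 0
        (D (u + fun q => (f (.gate q)).1) - D u, 0)
      else 0

/-- All verifications accept, as far as errors of type `a` are concerned. -/
def accAxis (κ : Kind) (a : Axis) (f : ExLoc S → Part) : Prop :=
  (∀ i b, ancAcc b a (fun ℓ => f (.lec i (.anc b ℓ)))) ∧
  (∀ i b, ancAcc b a (fun ℓ => f (.tec i (.anc b ℓ)))) ∧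
  (∀ b, κ = .prep b → ancAcc b a (fun ℓ => f (.anc ℓ)))

/-- All verifications accept. -/
def accepted (κ : Kind) (f : ExLoc S → Err) : Prop := ∀ a, accAxis κ a (fun ℓ => f ℓ a)

/-- Law of the logical error of an extended rectangle whose locations fail independently with
laws `ν`, conditioned on the acceptance of all verifications. -/
noncomputable def exLaw (κ : Kind) (v : Variant) (ν : ExLoc S → Err → ℝ) (e : Err) : ℝ :=
  cfgSum ν (fun f => accepted κ f ∧ ∀ a, logical κ v a (fun ℓ => f ℓ a) = e a) /
    cfgSum ν (fun f => accepted κ f)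

end ExRec

/-- The law without errors, used for locations that are not present. -/
noncomputable def noErr (e : Err) : ℝ := if e = 0 then 1 else 0

/-- The noise models of the levels of concatenation, starting from depolarizing noise. `level S γ k κ`
consists of the possible error laws of a level-`k` location of kind `κ`: at level zero a physical
location, at level `k + 1` a level-`(k + 1)` rectangle, replaced by the gate followed by
the logical error of its full or partial extended rectangle, whose locations are
independent level-`k` locations. -/
def level (S : Scheme) (γ : ℝ) : ℕ → Kind → Set (Err → ℝ)
  | 0, κ => {depol γ κ}
  | k + 1, κ => {μ | ∃ (v : Variant) (ν : ExLoc S → Err → ℝ),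
      (∀ ℓ, match kindAt κ v ℓ with
        | some κ' => ν ℓ ∈ level S γ k κ'
        | none => ν ℓ = noErr) ∧ μ = exLaw κ v ν}

/-- Probability of the malignant event `E` for a location with error law `μ`. -/
noncomputable def malProb (μ : Err → ℝ) (E : Mal) : ℝ :=
  ∑ e : Err, if e E.axis = E.err then μ e else 0

/-! ### The noise threshold -/

/-- A gate of a circuit on `n` qubits. -/
inductive Gate (n : ℕ)
  | cnot (i j : Fin n) (h : i ≠ j)
  | rest (i : Fin n)
  | prep (b : Axis) (i : Fin n)
  | meas (b : Axis) (i : Fin n)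

/-- The kind of a gate. -/
def Gate.kind {n : ℕ} : Gate n → Kind
  | .cnot _ _ _ => .cnot
  | .rest _ => .rest
  | .prep b _ => .prep b
  | .meas b _ => .meas b

/-- At noise strength `γ`, the probability that the simulation of any given circuit succeeds (all
its rectangles are correct) can be made arbitrarily close to one by sufficiently many levels of
concatenation. -/
def Tolerable (S : Scheme) (γ : ℝ) : Prop :=
  ∀ (n : ℕ) (C : List (Gate n)) (δ : ℝ), 0 < δ → ∃ k₀ : ℕ, ∀ k, k₀ ≤ k →
    ∀ ν : Fin C.length → Err → ℝ, (∀ i, ν i ∈ level S γ k (C.get i).kind) →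
      1 - δ ≤ cfgSum ν (fun f => ∀ i, f i = 0)

/-- The asymptotic noise threshold for depolarizing noise: the largest `g` such that all
`γ < g` are tolerable. (Depolarizing noise requires `γ ≤ 1 / 15`.) -/
noncomputable def noiseThreshold (S : Scheme) : ℝ :=
  sSup {g : ℝ | 0 ≤ g ∧ g ≤ 1 / 15 ∧ ∀ γ, 0 ≤ γ → γ < g → Tolerable S γ}

/-! ### Counting with the transformed noise model

In the transformed noise model with weights `α` and strength `t`, a location fails in the manner of
the malignant event `E` with probability at most `α E * t`; there is no bound but one for the
probability that it does not fail, and no information on correlations of `X` and `Z` errors. -/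

/-- Weight of the error `p` of type `a` at a location of kind `κ`. -/
noncomputable def weight (α : Mal → ℝ) (t : ℝ) (a : Axis) (κ : Kind) (p : Part) : ℝ :=
  if p = 0 then 1
  else ∑ E : Mal, if E.kind = κ ∧ E.axis = a ∧ E.err = p then α E * t else 0

/-- Weights of a location that cannot fail. -/
noncomputable def noFail (p : Part) : ℝ := if p = 0 then 1 else 0

/-- A bad event: for each listed component `(C, c)`, more than `c` locations of `C` fail. A single
component with its bound `k_good` is the typical case. -/
abbrev BadEvent (L : Type) := List (Finset L × ℕ)

section Counting
variable {L : Type} [Fintype L]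

/-- The bad event occurs in the configuration `f`. -/
def BadEvent.Occurs (B : BadEvent L) (f : L → Part) : Prop :=
  ∀ x ∈ B, x.2 < (x.1.filter fun ℓ => f ℓ ≠ 0).card

/-- The components of a bad event are disjoint. -/
def BadEvent.IsDisjoint (B : BadEvent L) : Prop := B.Pairwise fun x y => Disjoint x.1 y.1

/-- The least number of failures with which a bad event can occur. -/
def BadEvent.order (B : BadEvent L) : ℕ := (B.map fun x => x.2 + 1).sum

/-- Bound for the probability of a bad event: for each component, sum over its subsets of
`c + 1` locations of the product of the failure weights. -/
noncomputable def BadEvent.bound (w : L → Part → ℝ) (B : BadEvent L) : ℝ :=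
  (B.map fun x => ∑ T ∈ x.1.powersetCard (x.2 + 1), ∏ ℓ ∈ T, ∑ p : Part,
    if p = 0 then 0 else w ℓ p).prod

/-- A configuration is good if no bad event occurs. -/
def Good (Bs : List (BadEvent L)) (f : L → Part) : Prop := ∀ B ∈ Bs, ¬ B.Occurs f

/-- Counting bound for an event `A`: sum of the weights of the good configurations in `A`, plus the
bounds for the bad events. -/
noncomputable def countBound (w : L → Part → ℝ) (Bs : List (BadEvent L)) (A : (L → Part) → Prop) :
    ℝ :=
  cfgSum w (fun f => Good Bs f ∧ A f) + (Bs.map (BadEvent.bound w)).sum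

end Counting

/-- The choice of the bad events, i.e. of the faults that are not counted: `verify₁` for the first
check of a pair of ancillas, `verify₂` for the second check, `exRec` for the extended rectangles and
errors of type `a`. A bad event of an extended rectangle requires at least two failures. -/
structure Cutoffs (S : Scheme) where
  verify₁ : Axis → Fin 2 → List (BadEvent (AncLoc S))
  verify₂ : Axis → List (BadEvent (AncLoc S))
  exRec : Kind → Variant → Axis → List (BadEvent (ExLoc S))
  disjoint₁ : ∀ b s, ∀ B ∈ verify₁ b s, B.IsDisjoint
  disjoint₂ : ∀ b, ∀ B ∈ verify₂ b, B.IsDisjoint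
  disjoint : ∀ κ v a, ∀ B ∈ exRec κ v a, B.IsDisjoint
  two_le : ∀ κ v a, ∀ B ∈ exRec κ v a, 2 ≤ B.order

section LevelTwo
variable {S : Scheme}

/-- Weights of the errors of type `a` at the locations of an ancilla of type `b`. -/
noncomputable def ancWeight (α : Mal → ℝ) (t : ℝ) (b a : Axis) (ℓ : AncLoc S) : Part → ℝ :=
  weight α t a (ℓ.kind b)

/-- Lower bound for the acceptance probability of the first check of pair `s` of an ancilla of
type `b`. -/
noncomputable def accept₁ (cuts : Cutoffs S) (α : Mal → ℝ) (t : ℝ) (b : Axis) (s : Fin 2) : ℝ :=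
  1 - countBound (fun ℓ => if ℓ.pairLocs s then ancWeight α t b b ℓ else noFail)
    (cuts.verify₁ b s) (fun f => check₁ (orient b f) s ∉ stab)

/-- Lower bound for the acceptance probability of the second check of an ancilla of type `b`,
conditioned on the acceptance of the first checks. -/
noncomputable def accept₂ (cuts : Cutoffs S) (α : Mal → ℝ) (t : ℝ) (b : Axis) : ℝ :=
  1 - countBound (ancWeight α t b b.other) (cuts.verify₂ b) (fun f => check₂ (orient b f) ∉ code) /
    (accept₁ cuts α t b 0 * accept₁ cuts α t b 1)

/-- Lower bound for the probability that an ancilla of type `b` is accepted. -/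
noncomputable def acceptBound (cuts : Cutoffs S) (α : Mal → ℝ) (t : ℝ) (b : Axis) : ℝ :=
  accept₁ cuts α t b 0 * accept₁ cuts α t b 1 * accept₂ cuts α t b

/-- The lower bounds for the acceptance probabilities are positive. -/
def AcceptPos (cuts : Cutoffs S) (α : Mal → ℝ) (t : ℝ) : Prop :=
  ∀ b, (∀ s, 0 < accept₁ cuts α t b s) ∧ 0 < accept₂ cuts α t b

/-- The verified ancillas of an extended rectangle: the ancilla of type `b` of the leading or
trailing error correction on block `i`, or the ancilla of an encoded preparation. -/
abbrev AncIx := (Fin 2 × Axis) ⊕ (Fin 2 × Axis) ⊕ Unit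

/-- The type of a verified ancilla, `none` if it is not present. -/
def ancAt (κ : Kind) (v : Variant) : AncIx → Option Axis
  | .inl (i, b) => if lecOn κ i then some b else none
  | .inr (.inl (i, b)) => if tecOn κ v i then some b else none
  | .inr (.inr _) =>
      match κ with
      | .prep b => some b
      | _ => none

/-- The verified ancilla that a location belongs to, if any. -/
def ancOf : ExLoc S → Option AncIx
  | .inl (i, .inl (b, _)) => some (.inl (i, b))
  | .inr (.inr (.inl (i, .inl (b, _)))) => some (.inr (.inl (i, b)))
  | .inr (.inr (.inr (.inl _))) => some (.inr (.inr ()))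
  | _ => none

/-- Lower bound for the probability that all the ancillas satisfying `T` are accepted. -/
noncomputable def acceptAll (cuts : Cutoffs S) (α : Mal → ℝ) (t : ℝ) (κ : Kind) (v : Variant)
    (T : AncIx → Prop) : ℝ :=
  ∏ x : AncIx, if T x then
    (match ancAt κ v x with
      | some b => acceptBound cuts α t b
      | none => 1)
    else 1

/-- Weights of the errors of type `a` at the locations of an extended rectangle. -/
noncomputable def exWeight (α : Mal → ℝ) (t : ℝ) (κ : Kind) (v : Variant) (a : Axis)
    (ℓ : ExLoc S) : Part → ℝ :=
  match kindAt κ v ℓ with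
  | some κ' => weight α t a κ'
  | none => noFail

/-- The upper bound that counting yields for the probability of `E` in the variant `v` of the extended
rectangle: `Pr[mal_E, good] / Pr[accept] + Pr[bad | accept]`. Errors of the other type are ignored in
the numerators. The probability of a bad event is conditioned on the acceptance of the ancillas that
its components meet. -/
noncomputable def variantBound (cuts : Cutoffs S) (α : Mal → ℝ) (E : Mal) (v : Variant) (t : ℝ) :
    ℝ :=
  let κ := E.kind
  let w : ExLoc S → Part → ℝ := exWeight α t κ v E.axis
  let Bs := cuts.exRec κ v E.axis
  cfgSum w (fun f => Good Bs f ∧ accAxis κ E.axis f ∧ logical κ v E.axis f = E.err) /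
      acceptAll cuts α t κ v (fun _ => True) +
    (Bs.map fun B => B.bound w /
      acceptAll cuts α t κ v (fun x => ∃ y ∈ B, ∃ ℓ ∈ y.1, ancOf ℓ = some x)).sum

/-- The level-two bound `P^(2)_E(t)`, valid for the full and for the partial extended rectangles. -/
noncomputable def levelTwoBound (cuts : Cutoffs S) (α : Mal → ℝ) (E : Mal) (t : ℝ) : ℝ :=
  Finset.univ.sup' Finset.univ_nonempty fun v : Variant => variantBound cuts α E v t

end LevelTwo

end GolayFT

namespace GolayFT

open scoped Classical

/-! ### Sums over configurations of independent locations -/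

section CfgSum
variable {L K β β' : Type} [Fintype L] [Fintype K] [Fintype β] [Fintype β']

/-! The infinitely many levels are controlled by a single number. A location is bounded at strength
`t` if the law of its `X` part and the law of its `Z` part are each dominated by the weights `α E *
t` (`IsBounded`). Nothing is assumed about correlations of the two parts, and no failure has weight
one. Two facts about this class of noise carry the proof.

Counting is valid (`malProb_exLaw_le`): if the locations of an extended rectangle are bounded at `t`
and the acceptance bounds are positive, then the level-two bound at `t` dominates the conditional
probability of each malignant event. A union bound separates good configurations from bad events.
Different ancillas occupy disjoint locations, so their acceptances are independent; within one
ancilla the two first checks are independent and the rejections of the second are subtracted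
(`acceptBound_le`). For a bad event the acceptance of the ancillas it does not meet cancels
(`cfgSum_occurs_and_accepted_div_le`).

Counting contracts (`variantBound_mul_le`): a configuration with `n` failures has weight homogeneous
of degree `n` in `t`. By strict fault tolerance and the distance seven of the code, three failures
or fewer cause no logical error (`logical_eq_zero`), so good malignant configurations gain at least
`x ^ 4` when `t` becomes `x * t`, and a bad event gains `x` to its order. The acceptance bounds in
the denominators can only grow. Hence the bound gains `x ^ m` for every `m ≤ 4` not exceeding the
orders of the bad events.

The recursion starts at level one, where the bounds are hypotheses. With `T = Γ γth` and `x = Γ γ /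
T < 1`, the case `m = 2` gives strength `x ^ 2 ^ k * T` at level `k + 1` (`levelBounded_pow_two`).
This tends to zero, which yields the threshold, and it is faster than the stated rate because `4 * k
- 3 ≤ 2 * (2 ^ k - 1)`. The case `m = 4`, started from `γ` itself, gives the explicit rate
(`levelBounded_pow_four`). -/

theorem cfgSum_nonneg {w : L → β → ℝ} (hw : ∀ ℓ b, 0 ≤ w ℓ b) (A : (L → β) → Prop) :
    0 ≤ cfgSum w A :=
  Finset.sum_nonneg fun f _ => by
    split_ifs
    exacts [Finset.prod_nonneg fun ℓ _ => hw ℓ _, le_rfl]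

theorem cfgSum_mono {w : L → β → ℝ} (hw : ∀ ℓ b, 0 ≤ w ℓ b) {A B : (L → β) → Prop}
    (h : ∀ f, A f → B f) : cfgSum w A ≤ cfgSum w B :=
  Finset.sum_le_sum fun f _ => by
    have := Finset.prod_nonneg fun ℓ (_ : ℓ ∈ Finset.univ) => hw ℓ (f ℓ)
    by_cases hA : A f
    · simp [hA, h f hA]
    · simp only [hA, if_false]
      split_ifs
      exacts [this, le_rfl]

theorem cfgSum_mono_weight {w w' : L → β → ℝ} (hw : ∀ ℓ b, 0 ≤ w ℓ b)
    (h : ∀ ℓ b, w ℓ b ≤ w' ℓ b) (A : (L → β) → Prop) : cfgSum w A ≤ cfgSum w' A :=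
  Finset.sum_le_sum fun f _ => by
    split_ifs
    exacts [Finset.prod_le_prod (fun ℓ _ => hw ℓ _) fun ℓ _ => h ℓ _, le_rfl]

theorem cfgSum_congr {w : L → β → ℝ} {A B : (L → β) → Prop}
    (h : ∀ f, A f ↔ B f) : cfgSum w A = cfgSum w B := by
  congr 1; funext f; exact propext (h f)

/-- Distributivity of the product over the sums; with suitable `t` it computes all product events
below. -/
theorem cfgSum_forall (w : L → β → ℝ) (t : L → β → Prop) :
    cfgSum w (fun f => ∀ ℓ, t ℓ (f ℓ)) = ∏ ℓ, ∑ b, if t ℓ b then w ℓ b else 0 := by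
  rw [Finset.prod_univ_sum, Fintype.piFinset_univ]
  refine Finset.sum_congr rfl fun f _ => ?_
  by_cases h : ∀ ℓ, t ℓ (f ℓ)
  · simp [h]
  · rw [if_neg h]
    push Not at h
    obtain ⟨ℓ, hℓ⟩ := h
    exact (Finset.prod_eq_zero (Finset.mem_univ ℓ) (by simp [hℓ])).symm

theorem cfgSum_true {w : L → β → ℝ} (hw : ∀ ℓ, ∑ b, w ℓ b = 1) {A : (L → β) → Prop}
    (hA : ∀ f, A f) : cfgSum w A = 1 := by
  have := cfgSum_forall w (fun _ _ => True)
  simp only [if_true, hw, Finset.prod_const_one] at this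
  rw [← this]
  exact cfgSum_congr fun f => by simp [hA]

theorem cfgSum_add_cfgSum_not {w : L → β → ℝ} (hw : ∀ ℓ, ∑ b, w ℓ b = 1)
    (A : (L → β) → Prop) : cfgSum w A + cfgSum w (fun f => ¬ A f) = 1 := by
  rw [← cfgSum_true hw (fun _ : L → β => trivial), cfgSum, cfgSum, cfgSum,
    ← Finset.sum_add_distrib]
  refine Finset.sum_congr rfl fun f _ => ?_
  by_cases h : A f <;> simp [h]

theorem cfgSum_or_le {w : L → β → ℝ} (hw : ∀ ℓ b, 0 ≤ w ℓ b) (A B : (L → β) → Prop) :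
    cfgSum w (fun f => A f ∨ B f) ≤ cfgSum w A + cfgSum w B := by
  rw [cfgSum, cfgSum, cfgSum, ← Finset.sum_add_distrib]
  refine Finset.sum_le_sum fun f _ => ?_
  have := Finset.prod_nonneg fun ℓ (_ : ℓ ∈ Finset.univ) => hw ℓ (f ℓ)
  by_cases h : A f <;> by_cases h' : B f <;> simp [h, h', this]

theorem cfgSum_exists_finset_le {ι : Type} {w : L → β → ℝ} (hw : ∀ ℓ b, 0 ≤ w ℓ b)
    (s : Finset ι) (A : ι → (L → β) → Prop) :
    cfgSum w (fun f => ∃ i ∈ s, A i f) ≤ ∑ i ∈ s, cfgSum w (A i) := by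
  induction s using Finset.induction_on with
  | empty => simp [cfgSum]
  | insert i s hi ih =>
    rw [Finset.sum_insert hi]
    refine le_trans (le_of_eq (cfgSum_congr fun f => ?_))
      ((cfgSum_or_le hw (A i) (fun f => ∃ j ∈ s, A j f)).trans (by gcongr))
    simp

theorem cfgSum_exists_list_le {ι : Type} {w : L → β → ℝ} (hw : ∀ ℓ b, 0 ≤ w ℓ b)
    (s : List ι) (A : ι → (L → β) → Prop) :
    cfgSum w (fun f => ∃ i ∈ s, A i f) ≤ (s.map fun i => cfgSum w (A i)).sum := by
  induction s with
  | nil => simp [cfgSum]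
  | cons i s ih =>
    rw [List.map_cons, List.sum_cons]
    refine le_trans (le_of_eq (cfgSum_congr fun f => ?_))
      ((cfgSum_or_le hw (A i) (fun f => ∃ j ∈ s, A j f)).trans (by gcongr))
    simp

/-- The law of the image of a random error under `φ`. -/
noncomputable def mapLaw (φ : β → β') (μ : β → ℝ) (b' : β') : ℝ :=
  ∑ b, if φ b = b' then μ b else 0

theorem mapLaw_nonneg {φ : β → β'} {μ : β → ℝ} (hμ : ∀ b, 0 ≤ μ b) (b' : β') :
    0 ≤ mapLaw φ μ b' :=
  Finset.sum_nonneg fun b _ => by split_ifs <;> simp [hμ]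

theorem sum_mapLaw (φ : β → β') (μ : β → ℝ) : ∑ b', mapLaw φ μ b' = ∑ b, μ b := by
  unfold mapLaw
  rw [Finset.sum_comm]
  simp

/-- Configurations are grouped by their image. Applied to `e ↦ e a`, this passes from joint Pauli
errors to the marginal of one error type, the only law that counting controls. -/
theorem cfgSum_map (w : L → β → ℝ) (φ : β → β') (A : (L → β') → Prop) :
    cfgSum w (fun f => A fun ℓ => φ (f ℓ)) = cfgSum (fun ℓ => mapLaw φ (w ℓ)) A := by
  have key : ∀ g : L → β', ∏ ℓ, mapLaw φ (w ℓ) (g ℓ) =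
      ∑ f : L → β, if (fun ℓ => φ (f ℓ)) = g then ∏ ℓ, w ℓ (f ℓ) else 0 := fun g => by
    rw [show (∏ ℓ, mapLaw φ (w ℓ) (g ℓ)) = ∏ ℓ, ∑ b, if φ b = g ℓ then w ℓ b else 0 from rfl,
      ← cfgSum_forall w (fun ℓ b => φ b = g ℓ), cfgSum]
    refine Finset.sum_congr rfl fun f _ => ?_
    congr 1
    exact propext funext_iff.symm
  rw [cfgSum, cfgSum]
  simp only [key]
  have : ∀ g : L → β', (if A g then ∑ f : L → β, (if (fun ℓ => φ (f ℓ)) = g then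
      ∏ ℓ, w ℓ (f ℓ) else 0) else 0) = ∑ f : L → β, if (fun ℓ => φ (f ℓ)) = g then
      (if A (fun ℓ => φ (f ℓ)) then ∏ ℓ, w ℓ (f ℓ) else 0) else 0 := fun g => by
    split_ifs with h
    · refine Finset.sum_congr rfl fun f _ => ?_
      split_ifs with h1 h2 <;> simp_all
    · refine (Finset.sum_eq_zero fun f _ => ?_).symm
      split_ifs with h1 h2 <;> simp_all
  simp only [this]
  rw [Finset.sum_comm]
  simp

/-- The locations outside the range of `j` sum to one and drop out. This restricts an extended
rectangle to one of its ancillas. -/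
theorem cfgSum_comp_injective {w : L → β → ℝ} (hw : ∀ ℓ, ∑ b, w ℓ b = 1) {j : K → L}
    (hj : Function.Injective j) (A : (K → β) → Prop) :
    cfgSum w (fun f => A fun k => f (j k)) = cfgSum (fun k => w (j k)) A := by
  have key : ∀ g : K → β, ∏ k, w (j k) (g k) =
      ∑ f : L → β, if (fun k => f (j k)) = g then ∏ ℓ, w ℓ (f ℓ) else 0 := fun g => by
    -- The condition is vacuous outside the range of `j`, and by injectivity it fixes exactly one
    -- value inside.
    have h := cfgSum_forall w (fun ℓ b => ∀ k, j k = ℓ → b = g k)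
    rw [← Fintype.prod_of_injective j hj (fun k => w (j k) (g k))] at h
    · rw [← h, cfgSum]
      refine Finset.sum_congr rfl fun f _ => ?_
      congr 1
      rw [funext_iff]
      exact propext ⟨fun h k => h _ k rfl, fun h ℓ k hk => hk ▸ h k⟩
    · intro ℓ hℓ
      rw [← hw ℓ]
      refine Finset.sum_congr rfl fun b _ => if_pos fun k hk => absurd ⟨k, hk⟩ hℓ
    · intro k
      rw [Finset.sum_eq_single (g k)]
      · rw [if_pos]
        intro k' hk'
        rw [hj hk']
      · intro b _ hb
        rw [if_neg]
        exact fun h => hb (h k rfl)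
      · simp
  rw [cfgSum, cfgSum]
  simp only [key]
  have : ∀ g : K → β, (if A g then ∑ f : L → β, (if (fun k => f (j k)) = g then
      ∏ ℓ, w ℓ (f ℓ) else 0) else 0) = ∑ f : L → β, if (fun k => f (j k)) = g then
      (if A (fun k => f (j k)) then ∏ ℓ, w ℓ (f ℓ) else 0) else 0 := fun g => by
    split_ifs with h
    · refine Finset.sum_congr rfl fun f _ => ?_
      split_ifs with h1 h2 <;> simp_all
    · refine (Finset.sum_eq_zero fun f _ => ?_).symm
      split_ifs with h1 h2 <;> simp_all
  simp only [this]
  rw [Finset.sum_comm]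
  simp

/-- Exchanging two configurations outside of `s`. -/
noncomputable def exchange (s : Set L) : (L → β) × (L → β) ≃ (L → β) × (L → β) where
  toFun x := (s.piecewise x.1 x.2, s.piecewise x.2 x.1)
  invFun x := (s.piecewise x.1 x.2, s.piecewise x.2 x.1)
  left_inv x := by
    ext ℓ <;> by_cases h : ℓ ∈ s <;> simp [h]
  right_inv x := by
    ext ℓ <;> by_cases h : ℓ ∈ s <;> simp [h]

theorem cfgSum_mul_cfgSum (w w' : L → β → ℝ) (A B : (L → β) → Prop) :
    cfgSum w A * cfgSum w' B = ∑ x : (L → β) × (L → β),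
      if A x.1 ∧ B x.2 then ∏ ℓ, w ℓ (x.1 ℓ) * w' ℓ (x.2 ℓ) else 0 := by
  rw [cfgSum, cfgSum, Finset.sum_mul_sum, Fintype.sum_prod_type]
  refine Finset.sum_congr rfl fun f _ => Finset.sum_congr rfl fun g _ => ?_
  rw [Finset.prod_mul_distrib]
  by_cases hA : A f <;> by_cases hB : B g <;> simp [hA, hB]

/-- Events that depend on disjoint sets of locations are independent. -/
theorem cfgSum_and_of_dependsOn {w : L → β → ℝ} (hw : ∀ ℓ, ∑ b, w ℓ b = 1)
    {A B : (L → β) → Prop} {s : Set L} (hA : DependsOn A s) (hB : DependsOn B sᶜ) :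
    cfgSum w (fun f => A f ∧ B f) = cfgSum w A * cfgSum w B := by
  have h1 : cfgSum w (fun f => A f ∧ B f) =
      cfgSum w (fun f => A f ∧ B f) * cfgSum w (fun _ => True) := by
    rw [cfgSum_true hw (fun _ => trivial), mul_one]
  -- Both sides are now sums over pairs of independent copies. Exchanging the copies off `s`
  -- preserves the joint weight and moves `B` from the first copy to the second.
  rw [h1, cfgSum_mul_cfgSum, cfgSum_mul_cfgSum, ← Equiv.sum_comp (exchange s)]
  refine Finset.sum_congr rfl fun x _ => ?_
  have e1 : A ((exchange s x).1) = A x.1 := hA fun ℓ hℓ => by simp [exchange, hℓ]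
  have e2 : B ((exchange s x).1) = B x.2 :=
    hB fun ℓ hℓ => by simp only [exchange]; simp [Set.piecewise, show ℓ ∉ s from hℓ]
  rw [e1, e2]
  simp only [and_true]
  congr 1
  refine Finset.prod_congr rfl fun ℓ _ => ?_
  by_cases h : ℓ ∈ s <;> simp [exchange, h, mul_comm]

/-- The probability of an event depends only on the laws of the locations it depends on. -/
theorem cfgSum_eq_of_dependsOn {w w' : L → β → ℝ} (hw : ∀ ℓ, ∑ b, w ℓ b = 1)
    (hw' : ∀ ℓ, ∑ b, w' ℓ b = 1) {A : (L → β) → Prop} {s : Set L} (hA : DependsOn A s)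
    (h : ∀ ℓ ∈ s, w ℓ = w' ℓ) : cfgSum w A = cfgSum w' A := by
  have h1 : cfgSum w A = cfgSum w A * cfgSum w' (fun _ => True) := by
    rw [cfgSum_true hw' (fun _ => trivial), mul_one]
  have h2 : cfgSum w' A = cfgSum w' A * cfgSum w (fun _ => True) := by
    rw [cfgSum_true hw (fun _ => trivial), mul_one]
  -- The same exchange, now between a copy with laws `w` and one with laws `w'`: off `s` it swaps
  -- the laws, and on `s` they agree.
  rw [h1, h2, cfgSum_mul_cfgSum, cfgSum_mul_cfgSum, ← Equiv.sum_comp (exchange s)]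
  refine Finset.sum_congr rfl fun x _ => ?_
  have e1 : A ((exchange s x).1) = A x.1 := hA fun ℓ hℓ => by simp [exchange, hℓ]
  rw [e1]
  congr 1
  refine Finset.prod_congr rfl fun ℓ _ => ?_
  by_cases hs : ℓ ∈ s <;> simp [exchange, hs, mul_comm, h]

/-- Events that depend on the fibres of a map are independent. -/
theorem cfgSum_forall_mem_of_dependsOn {ι : Type} {w : L → β → ℝ}
    (hw : ∀ ℓ, ∑ b, w ℓ b = 1) (c : L → Option ι) (A : ι → (L → β) → Prop)
    (hA : ∀ i, DependsOn (A i) {ℓ | c ℓ = some i}) (T : Finset ι) :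
    cfgSum w (fun f => ∀ i ∈ T, A i f) = ∏ i ∈ T, cfgSum w (A i) := by
  induction T using Finset.induction_on with
  | empty => simpa using cfgSum_true hw (fun _ => trivial)
  | insert i T hi ih =>
    rw [Finset.prod_insert hi, ← ih, ← cfgSum_and_of_dependsOn hw (hA i)]
    · exact cfgSum_congr fun f => by simp
    · intro f g hfg
      refine propext (forall₂_congr fun j hj => ?_)
      refine iff_of_eq (hA j fun ℓ hℓ => hfg ℓ fun hℓ' => hi ?_)
      rw [Set.mem_ofPred_eq] at hℓ hℓ'
      rw [hℓ] at hℓ'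
      cases hℓ'
      exact hj

end CfgSum

/-! ### Bad events -/

section Bad
variable {L : Type} [Fintype L]

theorem sum_powersetCard_prod_nonneg {w : L → Part → ℝ} (hw : ∀ ℓ p, 0 ≤ w ℓ p) (C : Finset L)
    (n : ℕ) : 0 ≤ ∑ T ∈ C.powersetCard n, ∏ ℓ ∈ T, ∑ p : Part, if p = 0 then 0 else w ℓ p :=
  Finset.sum_nonneg fun _ _ => Finset.prod_nonneg fun ℓ _ => Finset.sum_nonneg fun p _ => by
    split_ifs
    exacts [le_rfl, hw ℓ p]

theorem BadEvent.bound_nonneg {w : L → Part → ℝ} (hw : ∀ ℓ p, 0 ≤ w ℓ p) (B : BadEvent L) :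
    0 ≤ B.bound w := by
  refine List.prod_nonneg fun y hy => ?_
  obtain ⟨x, -, rfl⟩ := List.mem_map.1 hy
  exact sum_powersetCard_prod_nonneg hw _ _

theorem cfgSum_forall_ne_zero {ν : L → Part → ℝ} (hν1 : ∀ ℓ, ∑ p, ν ℓ p = 1) (T : Finset L) :
    cfgSum ν (fun f => ∀ ℓ ∈ T, f ℓ ≠ 0) = ∏ ℓ ∈ T, ∑ p : Part, if p = 0 then 0 else ν ℓ p := by
  have := cfgSum_forall ν (fun ℓ p => ℓ ∈ T → p ≠ 0)
  rw [this, ← Finset.prod_subset (Finset.subset_univ T)]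
  · refine Finset.prod_congr rfl fun ℓ hℓ => Finset.sum_congr rfl fun p _ => ?_
    by_cases hp : p = 0 <;> simp [hp, hℓ]
  · intro ℓ _ hℓ
    simp [hℓ, hν1]

/-- More than `c` failures include `c + 1` chosen locations that all fail; a union bound over the
choices suffices. -/
theorem cfgSum_lt_card_le {ν w : L → Part → ℝ} (hν : ∀ ℓ p, 0 ≤ ν ℓ p)
    (hν1 : ∀ ℓ, ∑ p, ν ℓ p = 1) (h : ∀ ℓ p, ν ℓ p ≤ w ℓ p) (C : Finset L) (c : ℕ) :
    cfgSum ν (fun f => c < (C.filter fun ℓ => f ℓ ≠ 0).card) ≤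
      ∑ T ∈ C.powersetCard (c + 1), ∏ ℓ ∈ T, ∑ p : Part, if p = 0 then 0 else w ℓ p := by
  refine (cfgSum_mono hν fun f hf => ?_).trans ((cfgSum_exists_finset_le hν
    (C.powersetCard (c + 1)) (fun T f => ∀ ℓ ∈ T, f ℓ ≠ 0)).trans (Finset.sum_le_sum fun T _ => ?_))
  · obtain ⟨T, hT, hc⟩ := Finset.exists_subset_card_eq (Nat.succ_le_of_lt hf)
    exact ⟨T, Finset.mem_powersetCard.2 ⟨hT.trans (Finset.filter_subset _ _), hc⟩,
      fun ℓ hℓ => (Finset.mem_filter.1 (hT hℓ)).2⟩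
  · rw [cfgSum_forall_ne_zero hν1]
    refine Finset.prod_le_prod (fun ℓ _ => Finset.sum_nonneg fun p _ => ?_)
      fun ℓ _ => Finset.sum_le_sum fun p _ => ?_
    · split_ifs
      exacts [le_rfl, hν ℓ p]
    · split_ifs
      exacts [le_rfl, h ℓ p]

theorem BadEvent.dependsOn_occurs (B : BadEvent L) :
    DependsOn B.Occurs {ℓ | ∃ x ∈ B, ℓ ∈ x.1} := by
  intro f g hfg
  refine propext (forall₂_congr fun x hx => ?_)
  rw [Finset.filter_congr fun ℓ hℓ => by rw [hfg ℓ ⟨x, hx, hℓ⟩]]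

/-- Disjoint components are independent, so the bounds of the components multiply. -/
theorem BadEvent.cfgSum_occurs_le {ν w : L → Part → ℝ} (hν : ∀ ℓ p, 0 ≤ ν ℓ p)
    (hν1 : ∀ ℓ, ∑ p, ν ℓ p = 1) (h : ∀ ℓ p, ν ℓ p ≤ w ℓ p) {B : BadEvent L}
    (hB : B.IsDisjoint) : cfgSum ν B.Occurs ≤ B.bound w := by
  induction B with
  | nil =>
    rw [cfgSum_true hν1 (A := BadEvent.Occurs []) (fun f x hx => absurd hx List.not_mem_nil)]
    simp [BadEvent.bound]
  | cons x B ih =>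
    obtain ⟨hx, hB⟩ := List.pairwise_cons.1 hB
    have e : cfgSum ν (BadEvent.Occurs (x :: B)) =
        cfgSum ν (fun f => x.2 < (x.1.filter fun ℓ => f ℓ ≠ 0).card ∧ BadEvent.Occurs B f) :=
      cfgSum_congr fun f => by simp [BadEvent.Occurs]
    rw [e, cfgSum_and_of_dependsOn hν1 (s := (x.1 : Set L))]
    · rw [BadEvent.bound, List.map_cons, List.prod_cons]
      exact mul_le_mul (cfgSum_lt_card_le hν hν1 h _ _) (ih hB) (cfgSum_nonneg hν _)
        (sum_powersetCard_prod_nonneg (fun ℓ p => (hν ℓ p).trans (h ℓ p)) _ _)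
    · intro f g hfg
      dsimp only
      rw [Finset.filter_congr fun ℓ hℓ => by rw [hfg ℓ hℓ]]
    · refine (BadEvent.dependsOn_occurs B).mono ?_
      rintro ℓ ⟨y, hy, hℓ⟩ hℓ'
      exact Finset.disjoint_left.1 (hx y hy) hℓ' hℓ

/-- Counting bounds the probability of an event. -/
theorem cfgSum_le_countBound {ν w : L → Part → ℝ} (hν : ∀ ℓ p, 0 ≤ ν ℓ p)
    (hν1 : ∀ ℓ, ∑ p, ν ℓ p = 1) (h : ∀ ℓ p, ν ℓ p ≤ w ℓ p) {Bs : List (BadEvent L)}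
    (hBs : ∀ B ∈ Bs, B.IsDisjoint) (A : (L → Part) → Prop) :
    cfgSum ν A ≤ countBound w Bs A := by
  have h1 : cfgSum ν A ≤ cfgSum ν (fun f => (Good Bs f ∧ A f) ∨ ∃ B ∈ Bs, B.Occurs f) :=
    cfgSum_mono hν fun f hf => by
      by_cases hg : Good Bs f
      · exact .inl ⟨hg, hf⟩
      · unfold Good at hg
        push Not at hg
        exact .inr hg
  refine h1.trans ((cfgSum_or_le hν _ _).trans (add_le_add (cfgSum_mono_weight hν h _) ?_))
  exact (cfgSum_exists_list_le hν Bs _).trans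
    (List.sum_le_sum fun B hB => BadEvent.cfgSum_occurs_le hν hν1 h (hBs B hB))

end Bad

end GolayFT

namespace GolayFT

/-! ### The minimum distance of the Golay code -/

/-- The weight of the word without syndrome whose first twelve entries are given. -/
def wordWeight (a b c d e f g h i j k l : ZMod 2) : ℕ :=
  a.val + b.val + c.val + d.val + e.val + f.val + g.val + h.val + i.val + j.val + k.val + l.val +
    (b + e + h + i + j + k + l).val +
    (a + d + g + h + i + j + k).val +
    (b + c + e + f + g + k + l).val +
    (a + b + d + e + f + j + k).val +
    (a + b + c + d + h + k + l).val +
    (a + c + e + g + h + i + l).val +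
    (d + e + f + g + i + j + l).val +
    (c + d + e + f + h + i + k).val +
    (b + c + d + e + g + h + j).val +
    (a + b + c + d + f + g + i).val +
    (a + c + f + i + j + k + l).val

/-- Minimum distance seven, as a finite check of the `2 ^ 12` words. -/
theorem wordWeight_eq_zero_or : ∀ a b c d e f g h i j k l : ZMod 2,
    wordWeight a b c d e f g h i j k l = 0 ∨ 7 ≤ wordWeight a b c d e f g h i j k l := by
  decide +kernel

theorem golayGen_dotProduct_golayGen : ∀ i j, golayGen i ⬝ᵥ golayGen j = 0 := by
  decide +kernel

theorem hammingNorm_eq_sum_val (v : Blk) : hammingNorm v = ∑ q, (v q).val := by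
  have h : ∀ z : ZMod 2, (if z ≠ 0 then 1 else 0) = z.val := by decide
  rw [hammingNorm, Finset.card_filter]
  exact Finset.sum_congr rfl fun q _ => h _

open scoped Classical

theorem sum_blk {M : Type} [AddCommMonoid M] (F : Fin 23 → M) : ∑ q, F q =
    F 0 + F 1 + F 2 + F 3 + F 4 + F 5 + F 6 + F 7 + F 8 + F 9 + F 10 + F 11 +
      F 12 + F 13 + F 14 + F 15 + F 16 + F 17 + F 18 + F 19 + F 20 + F 21 + F 22 := by
  simp only [Fin.sum_univ_castSucc, Finset.univ_eq_empty, Finset.sum_empty, zero_add]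
  rfl

/-- The generators are in systematic form: each has exactly one nonzero entry among the last eleven
coordinates, all in different places. Every parity check therefore expresses one of these
coordinates by the first twelve. -/
theorem hammingNorm_eq_wordWeight {v : Blk} (hv : v ∈ code) : hammingNorm v =
    wordWeight (v 0) (v 1) (v 2) (v 3) (v 4) (v 5) (v 6) (v 7) (v 8) (v 9) (v 10) (v 11) := by
  have key : ∀ x y : ZMod 2, x + y = 0 → y = x := fun x y h =>
    ((CharTwo.add_eq_zero).1 h).symm
  have hd : ∀ i, ∑ j, golayGen i j * v j = 0 := hv
  have h0 := hd 0
  have h1 := hd 1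
  have h2 := hd 2
  have h3 := hd 3
  have h4 := hd 4
  have h5 := hd 5
  have h6 := hd 6
  have h7 := hd 7
  have h8 := hd 8
  have h9 := hd 9
  have h10 := hd 10
  clear hd hv
  rw [sum_blk] at h0 h1 h2 h3 h4 h5 h6 h7 h8 h9 h10
  simp [golayGen] at h0 h1 h2 h3 h4 h5 h6 h7 h8 h9 h10
  rw [hammingNorm_eq_sum_val, wordWeight, sum_blk]
  rw [key _ _ h0, key _ _ h1, key _ _ h2, key _ _ h3, key _ _ h4, key _ _ h5, key _ _ h6,
    key _ _ h7, key _ _ h8, key _ _ h9, key _ _ h10]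
  ring

theorem eq_zero_of_mem_code {v : Blk} (hv : v ∈ code) (h : hammingNorm v ≤ 6) : v = 0 := by
  rw [← hammingNorm_eq_zero]
  rw [hammingNorm_eq_wordWeight hv] at h ⊢
  exact (wordWeight_eq_zero_or _ _ _ _ _ _ _ _ _ _ _ _).resolve_right (by omega)

theorem zero_mem_code : (0 : Blk) ∈ code := fun i => by simp

theorem add_mem_code {u v : Blk} (hu : u ∈ code) (hv : v ∈ code) : u + v ∈ code := fun i => by
  rw [dotProduct_add, hu i, hv i, add_zero]

theorem stab_subset_code {v : Blk} (hv : v ∈ stab) : v ∈ code := by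
  refine Submodule.span_induction ?_ zero_mem_code (fun _ _ _ _ => add_mem_code) ?_ hv
  · rintro _ ⟨j, rfl⟩ i
    exact golayGen_dotProduct_golayGen i j
  · intro c v _ hv i
    rw [dotProduct_smul, hv i, smul_zero]

theorem hammingNorm_add_le (u v : Blk) : hammingNorm (u + v) ≤ hammingNorm u + hammingNorm v := by
  have := hammingDist_triangle (u + v) v 0
  rwa [hammingDist_zero_right, hammingDist_zero_right, hammingDist_comm,
    hammingDist_eq_hammingNorm, show -v + (u + v) = u by abel] at this

theorem Blk.add_self (v : Blk) : v + v = 0 := funext fun _ => CharTwo.add_self_eq_zero _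

/-- Two corrections of weight at most three for one syndrome differ by a word of `code` of weight at
most six, hence coincide. Perfectness of the code is not needed: a candidate is always at hand. -/
theorem corr_eq {m w : Blk} (hw : hammingNorm w ≤ 3) (h : m + w ∈ code) : corr m = w := by
  have hex : ∃ w : Blk, hammingNorm w ≤ 3 ∧ m + w ∈ code := ⟨w, hw, h⟩
  rw [corr, dif_pos hex]
  obtain ⟨h1, h2⟩ := hex.choose_spec
  set u := hex.choose
  have h3 : u + w ∈ code := by
    have := add_mem_code h2 h
    rwa [show m + u + (m + w) = m + m + (u + w) by abel, Blk.add_self, zero_add] at this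
  have h4 := eq_zero_of_mem_code h3 ((hammingNorm_add_le u w).trans (by omega))
  exact funext fun q => CharTwo.add_eq_zero.1 (congrFun h4 q)

/-! ### Fault tolerance of the extended rectangles -/

/-- Up to elements of `V`, the error `e` has weight at most `k`. -/
def Near (V : Set Blk) (k : ℕ) (e : Blk) : Prop := ∃ s ∈ V, hammingNorm (e + s) ≤ k

theorem Near.mono {V : Set Blk} {j k : ℕ} {e : Blk} (h : Near V j e) (hjk : j ≤ k) :
    Near V k e :=
  h.imp fun _ hs => ⟨hs.1, hs.2.trans hjk⟩

theorem near_of_hammingNorm_le {k : ℕ} {e : Blk} (h : hammingNorm e ≤ k) : Near stab k e :=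
  ⟨0, stab.zero_mem, by simpa using h⟩

theorem Near.add {j k : ℕ} {e e' : Blk} (h : Near stab j e) (h' : Near stab k e') :
    Near stab (j + k) (e + e') := by
  obtain ⟨s, hs, h⟩ := h
  obtain ⟨s', hs', h'⟩ := h'
  refine ⟨s + s', stab.add_mem hs hs', ?_⟩
  rw [add_add_add_comm]
  exact (hammingNorm_add_le _ _).trans (add_le_add h h')

theorem D_eq_zero {k : ℕ} {e : Blk} (h : Near stab k e) (hk : k ≤ 3) : D e = 0 := by
  rw [D, if_pos]
  exact h.mono hk

theorem numFail_eq_sum {L : Type} [Fintype L] (f : L → Part) :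
    numFail f = ∑ ℓ, if f ℓ ≠ 0 then 1 else 0 := by
  rw [numFail, Finset.card_filter]

theorem numFail_sum {L K : Type} [Fintype L] [Fintype K] (f : L ⊕ K → Part) :
    numFail f = numFail (fun ℓ => f (.inl ℓ)) + numFail (fun ℓ => f (.inr ℓ)) := by
  simp only [numFail_eq_sum, Fintype.sum_sum_type]

theorem numFail_fin_two {L : Type} [Fintype L] (f : Fin 2 × L → Part) :
    numFail f = numFail (fun ℓ => f (0, ℓ)) + numFail (fun ℓ => f (1, ℓ)) := by
  simp only [numFail_eq_sum, Fintype.sum_prod_type, Fin.sum_univ_two]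

theorem numFail_axis {L : Type} [Fintype L] (f : Axis × L → Part) :
    numFail f = numFail (fun ℓ => f (.X, ℓ)) + numFail (fun ℓ => f (.Z, ℓ)) := by
  simp only [numFail_eq_sum, Fintype.sum_prod_type]
  rw [show (Finset.univ : Finset Axis) = {.X, .Z} from rfl, Finset.sum_pair (by decide)]

/-- A failing location counts once whatever component of its error is read off. Taking for `g` the
sum of both entries charges a CNOT once even when both its outputs enter the residual error. -/
theorem hammingNorm_comp_le (f : Fin 23 → Part) {g : Part → ZMod 2} (hg : g 0 = 0) :
    hammingNorm (fun q => g (f q)) ≤ numFail f := by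
  refine Finset.card_le_card fun q hq => ?_
  simp only [Finset.mem_filter, Finset.mem_univ, true_and] at hq ⊢
  exact fun h => hq (by rw [h, hg])

theorem canErr_cnot (a : Axis) (p : Part) : CanErr a .cnot p := by
  obtain ⟨x, y⟩ := p
  have h2 : ∀ z : ZMod 2, z = 0 ∨ z = 1 := by decide
  rcases h2 x with rfl | rfl <;> rcases h2 y with rfl | rfl
  · exact .inl rfl
  all_goals
    cases a
    · first
      | exact .inr ⟨.IX, rfl, rfl, rfl⟩
      | exact .inr ⟨.XI, rfl, rfl, rfl⟩
      | exact .inr ⟨.XX, rfl, rfl, rfl⟩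
    · first
      | exact .inr ⟨.IZ, rfl, rfl, rfl⟩
      | exact .inr ⟨.ZI, rfl, rfl, rfl⟩
      | exact .inr ⟨.ZZ, rfl, rfl, rfl⟩

/-- The kind of location that plays the same role in the dual circuit. -/
def Kind.dual : Kind → Kind
  | .cnot => .cnot
  | .rest => .rest
  | .prep b => .prep b.other
  | .meas b => .meas b.other

theorem CanErr.dual {a : Axis} {κ : Kind} {p : Part} (h : CanErr a κ p) (hκ : κ ≠ .cnot) :
    CanErr a.other κ.dual p := by
  rcases h with rfl | ⟨E, rfl, rfl, rfl⟩
  · exact .inl rfl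
  · cases E <;> first
      | exact absurd rfl hκ
      | exact .inr ⟨.prepX, rfl, rfl, rfl⟩
      | exact .inr ⟨.prepZ, rfl, rfl, rfl⟩
      | exact .inr ⟨.measX, rfl, rfl, rfl⟩
      | exact .inr ⟨.measZ, rfl, rfl, rfl⟩
      | exact .inr ⟨.restX, rfl, rfl, rfl⟩
      | exact .inr ⟨.restZ, rfl, rfl, rfl⟩

theorem AncLoc.kind_dual {S : Scheme} (ℓ : AncLoc S) : (ℓ.kind .Z).dual = ℓ.kind .X := by
  rcases ℓ with ⟨i, q⟩ | ⟨i, n⟩ | _ | _ | _ | _ | _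
  · cases h : (S i).plus q <;> simp [AncLoc.kind, Kind.dual, Axis.other, h]
  · simp only [AncLoc.kind]
    cases (S i).gates.get n <;> rfl
  all_goals rfl

/-! ### Few failures in verified ancillas, error corrections and extended rectangles. -/

section FaultTolerance
variable {S : Scheme}

/-- Duality: strict fault tolerance is assumed for `|0⟩` only. Errors of a `|+⟩` ancilla become
admissible errors of the `|0⟩` circuit when `X` and `Z` are exchanged; the swapped CNOT errors need
no check, as `canErr_cnot` admits all of them. -/
theorem canErr_orient {b a : Axis} {f : AncLoc S → Part}
    (hf : ∀ ℓ, CanErr a (ℓ.kind b) (f ℓ)) (ℓ : AncLoc S) :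
    CanErr (role b a) (ℓ.kind .X) (orient b f ℓ) := by
  have h := hf ℓ
  cases b
  · simpa [orient, role] using h
  · rw [← AncLoc.kind_dual]
    by_cases hk : ℓ.kind .Z = .cnot
    · rw [hk]
      exact canErr_cnot _ _
    · simpa [orient, hk, role] using h.dual hk

theorem numFail_orient (b : Axis) (f : AncLoc S → Part) : numFail (orient b f) = numFail f := by
  have h : ∀ ℓ, orient b f ℓ = 0 ↔ f ℓ = 0 := fun ℓ => by
    unfold orient
    split_ifs <;> simp [Prod.ext_iff, and_comm]
  simp only [numFail, ne_eq, h]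

theorem near_ancOut_same (hft : StrictlyFaultTolerant S) {a : Axis} {f : AncLoc S → Part}
    (hf : ∀ ℓ, CanErr a (ℓ.kind a) (f ℓ)) (hacc : ancAcc a a f) (h3 : numFail f ≤ 3) :
    Near stab (numFail f) (ancOut a a f) := by
  have e : role a a = .X := by cases a <;> rfl
  have h := canErr_orient hf
  rw [← numFail_orient a] at h3 ⊢
  rw [ancAcc, e] at hacc
  rw [e] at h
  rw [ancOut, e]
  exact hft.1 _ h hacc h3

/-- For this error type the logical operator stabilizes the ancilla state, so the error is
controlled only modulo `code`. That is enough, because in error correction this error reaches the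
syndrome measurement but not the data. -/
theorem near_ancOut_other (hft : StrictlyFaultTolerant S) {b a : Axis} (hab : b = a.other)
    {f : AncLoc S → Part}
    (hf : ∀ ℓ, CanErr a (ℓ.kind b) (f ℓ)) (hacc : ancAcc b a f) (h3 : numFail f ≤ 3) :
    Near code (numFail f) (ancOut b a f) := by
  have e : role b a = .Z := by subst hab; cases a <;> rfl
  have h := canErr_orient hf
  rw [← numFail_orient b] at h3 ⊢
  rw [ancAcc, e] at hacc
  rw [e] at h
  rw [ancOut, e]
  exact hft.2 _ h hacc h3

theorem numFail_ecLoc (f : ECLoc S → Part) : numFail f =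
    (numFail (fun ℓ => f (.anc .X ℓ)) + numFail (fun ℓ => f (.anc .Z ℓ))) +
    ((numFail (fun q => f (.pause .X q)) + numFail (fun q => f (.pause .Z q))) +
    ((numFail (fun q => f (.cnot .X q)) + numFail (fun q => f (.cnot .Z q))) +
    (numFail (fun q => f (.meas .X q)) + numFail (fun q => f (.meas .Z q))))) := by
  rw [numFail_sum, numFail_sum, numFail_sum, numFail_axis, numFail_axis, numFail_axis,
    numFail_axis]

theorem hammingNorm_add_le_of_le {u v : Blk} {m n : ℕ} (hu : hammingNorm u ≤ m)
    (hv : hammingNorm v ≤ n) : hammingNorm (u + v) ≤ m + n :=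
  (hammingNorm_add_le u v).trans (add_le_add hu hv)

/-- `X` errors of the `|0⟩` ancilla enter the data during the first half and are seen, together with
the input error, by the second. -/
theorem ecOut_X (e : Blk) (f : ECLoc S → Part) :
    let d : Blk := e + ancOut .X .X (fun ℓ => f (.anc .X ℓ)) + (fun q => (f (.pause .X q)).1) +
      fun q => (f (.cnot .X q)).2
    ecOut .X e f = d + (fun q => (f (.cnot .Z q)).1) +
      corr (d + ancOut .Z .X (fun ℓ => f (.anc .Z ℓ)) + (fun q => (f (.pause .Z q)).1) +
        (fun q => (f (.cnot .Z q)).2) + (fun q => (f (.meas .Z q)).1)) := by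
  intro d
  have hd : (fun q => (cnotProp Axis.X (ancOut .X .X (fun ℓ => f (.anc .X ℓ)) q +
      (f (.pause .X q)).1, e q) + f (.cnot .X q)).2) = d := by
    funext q
    simp only [cnotProp, d, Pi.add_apply, Prod.snd_add]
    ring
  simp only [ecOut, if_true, reduceCtorEq, if_false, hd]
  refine congrArg₂ _ rfl (congrArg corr ?_)
  funext q
  simp only [cnotProp, Pi.add_apply, Prod.snd_add]
  ring

/-- For `Z` errors the order is reversed: the correction comes first, and errors leaking from the
`|+⟩` ancilla remain uncorrected. -/
theorem ecOut_Z (e : Blk) (f : ECLoc S → Part) :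
    ecOut .Z e f = e + (fun q => (f (.cnot .X q)).2) +
      corr (e + ancOut .X .Z (fun ℓ => f (.anc .X ℓ)) + (fun q => (f (.pause .X q)).1) +
        (fun q => (f (.cnot .X q)).1) + (fun q => (f (.meas .X q)).1)) +
      ancOut .Z .Z (fun ℓ => f (.anc .Z ℓ)) + (fun q => (f (.pause .Z q)).1) +
      (fun q => (f (.cnot .Z q)).1) := by
  have hm : (fun q => (cnotProp Axis.Z (ancOut .X .Z (fun ℓ => f (.anc .X ℓ)) q +
      (f (.pause .X q)).1, e q) + f (.cnot .X q)).1 + (f (.meas .X q)).1) =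
      e + ancOut .X .Z (fun ℓ => f (.anc .X ℓ)) + (fun q => (f (.pause .X q)).1) +
        (fun q => (f (.cnot .X q)).1) + (fun q => (f (.meas .X q)).1) := by
    funext q
    simp only [cnotProp, Pi.add_apply, Prod.fst_add]
    ring
  simp only [ecOut, if_true, reduceCtorEq, if_false, hm]
  funext q
  simp only [cnotProp, Pi.add_apply, Prod.fst_add, Prod.snd_add]
  ring

/-- Error correction with few failures and a low-weight input error: the weight of the output
error is at most the number of failures. -/
theorem near_ecOut (hft : StrictlyFaultTolerant S) {a : Axis} {e : Blk} {r : ℕ}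
    {f : ECLoc S → Part} (he : Near stab r e) (hf : ∀ ℓ, CanErr a ℓ.kind (f ℓ))
    (hacc : ∀ b, ancAcc b a (fun ℓ => f (.anc b ℓ))) (h3 : r + numFail f ≤ 3) :
    Near stab (numFail f) (ecOut a e f) := by
  have hn := numFail_ecLoc f
  have hp := fun b => hammingNorm_comp_le (fun q => f (.pause b q)) (g := Prod.fst) rfl
  have hm := fun b => hammingNorm_comp_le (fun q => f (.meas b q)) (g := Prod.fst) rfl
  have hc1 := fun b => hammingNorm_comp_le (fun q => f (.cnot b q)) (g := Prod.fst) rfl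
  have hc2 := fun b => hammingNorm_comp_le (fun q => f (.cnot b q)) (g := Prod.snd) rfl
  have hc3 := fun b => hammingNorm_comp_le (fun q => f (.cnot b q))
    (g := fun p => p.1 + p.2) rfl
  obtain ⟨s, hs, he⟩ := he
  generalize hηd : e + s = η at he
  obtain rfl : e = η + s := by rw [← hηd, add_assoc, Blk.add_self, add_zero]
  cases a with
  | X =>
    obtain ⟨s', hs', hx⟩ := near_ancOut_same hft (a := .X) (f := fun ℓ => f (.anc .X ℓ))
      (fun ℓ => hf (.anc .X ℓ)) (hacc .X) (by omega)
    obtain ⟨c, hc, hz⟩ := near_ancOut_other hft (a := .X) (b := .Z) rfl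
      (f := fun ℓ => f (.anc .Z ℓ)) (fun ℓ => hf (.anc .Z ℓ)) (hacc .Z) (by omega)
    rw [ecOut_X]
    generalize hξd : ancOut .X .X (fun ℓ => f (.anc .X ℓ)) + s' = ξ at hx
    rw [show ancOut .X .X (fun ℓ => f (.anc .X ℓ)) = ξ + s' by
      rw [← hξd, add_assoc, Blk.add_self, add_zero]]
    generalize hζd : ancOut .Z .X (fun ℓ => f (.anc .Z ℓ)) + c = ζ at hz
    rw [show ancOut .Z .X (fun ℓ => f (.anc .Z ℓ)) = ζ + c by
      rw [← hζd, add_assoc, Blk.add_self, add_zero]]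
    have hpX := hp .X
    have hpZ := hp .Z
    have hmZ := hm .Z
    have hcX := hc2 .X
    have hcZ := hc2 .Z
    have hcZ' := hc3 .Z
    have hcadd : (fun q => (f (.cnot .Z q)).1 + (f (.cnot .Z q)).2) =
      (fun q => (f (.cnot .Z q)).1) + (fun q => (f (.cnot .Z q)).2) := rfl
    rw [hcadd] at hcZ'
    clear hm hp hc1 hc2 hc3 hcadd
    generalize (fun q => (f (.pause .X q)).1) = pX at *
    generalize (fun q => (f (.pause .Z q)).1) = pZ at *
    generalize (fun q => (f (.meas .Z q)).1) = mZ at *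
    generalize (fun q => (f (.cnot .X q)).2) = cX at *
    generalize (fun q => (f (.cnot .Z q)).1) = cZ at *
    generalize (fun q => (f (.cnot .Z q)).2) = cZ' at *
    -- Modulo `code` the measured word is the sum of the low-weight errors. Its weight is at most
    -- the input weight plus the number of failures, hence at most three, so the correction is this
    -- sum itself.
    have hcorr := corr_eq (m := η + s + (ξ + s') + pX + cX + (ζ + c) + pZ + cZ' + mZ)
      (w := η + ξ + pX + cX + (ζ + pZ + cZ' + mZ)) (by
        refine (hammingNorm_add_le_of_le (hammingNorm_add_le_of_le (hammingNorm_add_le_of_le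
          (hammingNorm_add_le_of_le he hx) hpX) hcX) (hammingNorm_add_le_of_le
          (hammingNorm_add_le_of_le (hammingNorm_add_le_of_le hz hpZ) hcZ) hmZ)).trans ?_
        omega) (by
        have := add_mem_code (add_mem_code (stab_subset_code hs) (stab_subset_code hs')) hc
        convert this using 1
        funext q
        simp only [Pi.add_apply]
        grind)
    rw [hcorr]
    refine ⟨s + s', stab.add_mem hs hs', ?_⟩
    -- The correction cancels the input error and the faults of the first half; only errors of the
    -- measurement half survive. The word `c` affected the syndrome alone and is absent.
    have : η + s + (ξ + s') + pX + cX + cZ + (η + ξ + pX + cX + (ζ + pZ + cZ' + mZ)) + (s + s') =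
        ζ + pZ + (cZ + cZ') + mZ := by
      funext q
      simp only [Pi.add_apply]
      grind
    rw [this]
    refine (hammingNorm_add_le_of_le (hammingNorm_add_le_of_le
      (hammingNorm_add_le_of_le hz hpZ) hcZ') hmZ).trans ?_
    omega
  | Z =>
    obtain ⟨s', hs', hz⟩ := near_ancOut_same hft (a := .Z) (f := fun ℓ => f (.anc .Z ℓ))
      (fun ℓ => hf (.anc .Z ℓ)) (hacc .Z) (by omega)
    obtain ⟨c, hc, hx⟩ := near_ancOut_other hft (a := .Z) (b := .X) rfl
      (f := fun ℓ => f (.anc .X ℓ)) (fun ℓ => hf (.anc .X ℓ)) (hacc .X) (by omega)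
    rw [ecOut_Z]
    generalize hξd : ancOut .X .Z (fun ℓ => f (.anc .X ℓ)) + c = ξ at hx
    rw [show ancOut .X .Z (fun ℓ => f (.anc .X ℓ)) = ξ + c by
      rw [← hξd, add_assoc, Blk.add_self, add_zero]]
    generalize hζd : ancOut .Z .Z (fun ℓ => f (.anc .Z ℓ)) + s' = ζ at hz
    rw [show ancOut .Z .Z (fun ℓ => f (.anc .Z ℓ)) = ζ + s' by
      rw [← hζd, add_assoc, Blk.add_self, add_zero]]
    have hpX := hp .X
    have hpZ := hp .Z
    have hmX := hm .X
    have hcX := hc1 .X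
    have hcZ := hc1 .Z
    have hcX' := hc3 .X
    have hcadd : (fun q => (f (.cnot .X q)).1 + (f (.cnot .X q)).2) =
      (fun q => (f (.cnot .X q)).1) + (fun q => (f (.cnot .X q)).2) := rfl
    rw [hcadd] at hcX'
    clear hm hp hc1 hc2 hc3 hcadd
    generalize (fun q => (f (.pause .X q)).1) = pX at *
    generalize (fun q => (f (.pause .Z q)).1) = pZ at *
    generalize (fun q => (f (.meas .X q)).1) = mX at *
    generalize (fun q => (f (.cnot .X q)).2) = cX' at *
    generalize (fun q => (f (.cnot .X q)).1) = cX at *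
    generalize (fun q => (f (.cnot .Z q)).1) = cZ at *
    have hcorr := corr_eq (m := η + s + (ξ + c) + pX + cX + mX)
      (w := η + ξ + pX + cX + mX) (by
        refine (hammingNorm_add_le_of_le (hammingNorm_add_le_of_le (hammingNorm_add_le_of_le
          (hammingNorm_add_le_of_le he hx) hpX) hcX) hmX).trans ?_
        omega) (by
        have := add_mem_code (stab_subset_code hs) hc
        convert this using 1
        funext q
        simp only [Pi.add_apply]
        grind)
    rw [hcorr]
    refine ⟨s + s', stab.add_mem hs hs', ?_⟩
    -- The input error cancels again. What survives is the noise of the syndrome measurement and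
    -- that of the second half, each failure being counted once.
    have : η + s + cX' + (η + ξ + pX + cX + mX) + (ζ + s') + pZ + cZ + (s + s') =
        ξ + pX + (cX + cX') + mX + ζ + pZ + cZ := by
      funext q
      simp only [Pi.add_apply]
      grind
    rw [this]
    refine (hammingNorm_add_le_of_le (hammingNorm_add_le_of_le (hammingNorm_add_le_of_le
      (hammingNorm_add_le_of_le (hammingNorm_add_le_of_le (hammingNorm_add_le_of_le hx hpX) hcX')
      hmX) hz) hpZ) hcZ).trans ?_
    omega

theorem numFail_exLoc (f : ExLoc S → Part) : numFail f =
    (numFail (fun ℓ => f (.lec 0 ℓ)) + numFail (fun ℓ => f (.lec 1 ℓ))) +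
    (numFail (fun q => f (.gate q)) +
    ((numFail (fun ℓ => f (.tec 0 ℓ)) + numFail (fun ℓ => f (.tec 1 ℓ))) +
    (numFail (fun ℓ => f (.anc ℓ)) + numFail (fun q => f (.pause q))))) := by
  rw [numFail_sum, numFail_sum, numFail_sum, numFail_sum, numFail_fin_two, numFail_fin_two]

/-- The errors of the locations of an extended rectangle can occur. -/
def CanErrAt (κ : Kind) (v : Variant) (a : Axis) (f : ExLoc S → Part) : Prop :=
  ∀ ℓ, match kindAt κ v ℓ with
    | some κ' => CanErr a κ' (f ℓ)
    | none => f ℓ = 0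

theorem CanErrAt.lec {κ : Kind} {v : Variant} {a : Axis} {f : ExLoc S → Part}
    (h : CanErrAt κ v a f) (i : Fin 2) (ℓ : ECLoc S) : CanErr a ℓ.kind (f (.lec i ℓ)) := by
  have := h (.lec i ℓ)
  by_cases hi : lecOn κ i
  · simpa [kindAt, hi] using this
  · exact .inl (by simpa [kindAt, hi] using this)

theorem CanErrAt.tec {κ : Kind} {v : Variant} {a : Axis} {f : ExLoc S → Part}
    (h : CanErrAt κ v a f) (i : Fin 2) (ℓ : ECLoc S) : CanErr a ℓ.kind (f (.tec i ℓ)) := by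
  have := h (.tec i ℓ)
  by_cases hi : tecOn κ v i
  · simpa [kindAt, hi] using this
  · exact .inl (by simpa [kindAt, hi] using this)

/-- With the trailing correction, its own failures bound the output weight; without it, `r` does.
This treats full and partial rectangles alike. -/
theorem D_tecOut_eq_zero (hft : StrictlyFaultTolerant S) {κ : Kind} {v : Variant} {a : Axis}
    {f : ExLoc S → Part} (hf : CanErrAt κ v a f) (hacc : accAxis κ a f) {i : Fin 2} {r : ℕ}
    {e : Blk} (he : Near stab r e) (h3 : r + numFail (fun ℓ => f (.tec i ℓ)) ≤ 3) :
    D (tecOut κ v a f i e) = 0 := by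
  unfold tecOut
  split_ifs
  · exact D_eq_zero (near_ecOut hft he (hf.tec i) (hacc.2.1 i) h3) (by omega)
  · exact D_eq_zero he (by omega)

/-- Fault tolerance: at most three failures do not cause a logical error. -/
theorem logical_eq_zero (hft : StrictlyFaultTolerant S) {κ : Kind} {v : Variant} {a : Axis}
    {f : ExLoc S → Part} (hf : CanErrAt κ v a f) (hacc : accAxis κ a f) (h3 : numFail f ≤ 3) :
    logical κ v a f = 0 := by
  rw [numFail_exLoc] at h3
  have hl : ∀ i, numFail (fun ℓ => f (.lec i ℓ)) ≤ 3 →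
      Near stab (numFail (fun ℓ => f (.lec i ℓ))) (lecOut a f i) := fun i hi =>
    near_ecOut hft (r := 0) ⟨0, stab.zero_mem, by simp⟩ (hf.lec i) (hacc.1 i) (by omega)
  have l0 := hl 0 (by omega)
  have l1 := hl 1 (by omega)
  have d0 := D_eq_zero l0 (by omega)
  have d1 := D_eq_zero l1 (by omega)
  have g1 := near_of_hammingNorm_le
    (hammingNorm_comp_le (fun q => f (.gate q)) (g := Prod.fst) rfl)
  have g2 := near_of_hammingNorm_le
    (hammingNorm_comp_le (fun q => f (.gate q)) (g := Prod.snd) rfl)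
  cases κ with
  | cnot =>
    -- The CNOT copies errors between the blocks, so one output block can carry the failures of both
    -- leading corrections. The total budget of three covers either block.
    have l01 := l0.add l1
    simp only [logical]
    rw [D_tecOut_eq_zero hft hf hacc (r := numFail (fun ℓ => f (.lec 0 ℓ)) +
        numFail (fun ℓ => f (.lec 1 ℓ)) + numFail (fun q => f (.gate q))) _ (by omega),
      D_tecOut_eq_zero hft hf hacc (r := numFail (fun ℓ => f (.lec 0 ℓ)) +
        numFail (fun ℓ => f (.lec 1 ℓ)) + numFail (fun q => f (.gate q))) _ (by omega), d0, d1]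
    · cases a <;> rfl
    · cases a
      · exact l01.add g2
      · exact (l1.mono (by omega)).add g2
    · cases a
      · exact (l0.mono (by omega)).add g1
      · exact l01.add g1
  | rest =>
    simp only [logical]
    rw [D_tecOut_eq_zero hft hf hacc (l0.add g1) (by omega), d0]
    rfl
  | prep b =>
    simp only [logical]
    split_ifs with hab
    · subst hab
      have ha := near_ancOut_same hft (f := fun ℓ => f (.anc ℓ)) (fun ℓ => hf (.anc ℓ))
        (hacc.2.2 a rfl) (by omega)
      have hp := near_of_hammingNorm_le
        (hammingNorm_comp_le (fun q => f (.pause q)) (g := Prod.fst) rfl)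
      rw [D_tecOut_eq_zero hft hf hacc (ha.add hp) (by omega)]
      rfl
    · rfl
  | meas b =>
    simp only [logical]
    split_ifs with hab
    · rw [D_eq_zero (l0.add g1) (by omega), d0]
      rfl
    · rfl

end FaultTolerance

/-! ### Dependence of the counting bounds on the noise strength -/

section Scaling
variable {L : Type} [Fintype L]

theorem prod_eq_pow_numFail_mul {w w' : L → Part → ℝ} {x : ℝ} (h0 : ∀ ℓ, w' ℓ 0 = w ℓ 0)
    (h : ∀ ℓ p, p ≠ 0 → w' ℓ p = x * w ℓ p) (f : L → Part) :
    ∏ ℓ, w' ℓ (f ℓ) = x ^ numFail f * ∏ ℓ, w ℓ (f ℓ) := by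
  have : x ^ numFail f = ∏ ℓ, if f ℓ ≠ 0 then x else 1 := by
    rw [numFail, ← Finset.prod_const, Finset.prod_filter]
  rw [this, ← Finset.prod_mul_distrib]
  refine Finset.prod_congr rfl fun ℓ _ => ?_
  by_cases hf : f ℓ = 0
  · simp [hf, h0]
  · simp [hf, h ℓ _ hf]

/-- The weight of a configuration is homogeneous of degree its number of failures, since no failure
has a weight independent of the strength. Only configurations of nonzero weight have to be examined.
-/
theorem cfgSum_scale_le {w w' : L → Part → ℝ} {x : ℝ} (hx : 0 ≤ x) (hx1 : x ≤ 1)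
    (hw : ∀ ℓ p, 0 ≤ w ℓ p) (h0 : ∀ ℓ, w' ℓ 0 = w ℓ 0)
    (h : ∀ ℓ p, p ≠ 0 → w' ℓ p = x * w ℓ p) {A : (L → Part) → Prop} {m : ℕ}
    (hA : ∀ f, A f → (∀ ℓ, w ℓ (f ℓ) ≠ 0) → m ≤ numFail f) :
    cfgSum w' A ≤ x ^ m * cfgSum w A := by
  rw [cfgSum, cfgSum, Finset.mul_sum]
  refine Finset.sum_le_sum fun f _ => ?_
  split_ifs with hf
  · rw [prod_eq_pow_numFail_mul h0 h]
    by_cases hz : ∏ ℓ, w ℓ (f ℓ) = 0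
    · simp [hz]
    · exact mul_le_mul_of_nonneg_right (pow_le_pow_of_le_one hx hx1
        (hA f hf fun ℓ => Finset.prod_ne_zero_iff.1 hz ℓ (Finset.mem_univ ℓ)))
        (Finset.prod_nonneg fun ℓ _ => hw ℓ _)
  · simp

/-- Each component contributes an elementary symmetric polynomial of degree `c + 1` in the failure
weights. -/
theorem BadEvent.bound_scale {w w' : L → Part → ℝ} {x : ℝ}
    (h : ∀ ℓ p, p ≠ 0 → w' ℓ p = x * w ℓ p) (B : BadEvent L) :
    B.bound w' = x ^ B.order * B.bound w := by
  have hp : ∀ ℓ, (∑ p : Part, if p = 0 then 0 else w' ℓ p) =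
      x * ∑ p : Part, if p = 0 then 0 else w ℓ p := fun ℓ => by
    rw [Finset.mul_sum]
    refine Finset.sum_congr rfl fun p _ => ?_
    by_cases hp : p = 0
    · simp [hp]
    · simp [hp, h ℓ p hp]
  induction B with
  | nil => simp [BadEvent.bound, BadEvent.order]
  | cons y B ih =>
    have e : ∀ u : L → Part → ℝ, BadEvent.bound u (y :: B) =
        (∑ T ∈ y.1.powersetCard (y.2 + 1), ∏ ℓ ∈ T, ∑ p : Part, if p = 0 then 0 else u ℓ p) *
          BadEvent.bound u B := fun u => rfl
    have e' : BadEvent.order (y :: B) = (y.2 + 1) + BadEvent.order B := rfl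
    rw [e, e, e', ih, pow_add]
    have : ∑ T ∈ y.1.powersetCard (y.2 + 1), ∏ ℓ ∈ T, ∑ p : Part, (if p = 0 then 0 else w' ℓ p) =
        x ^ (y.2 + 1) * ∑ T ∈ y.1.powersetCard (y.2 + 1), ∏ ℓ ∈ T, ∑ p : Part,
          if p = 0 then 0 else w ℓ p := by
      rw [Finset.mul_sum]
      refine Finset.sum_congr rfl fun T hT => ?_
      simp only [hp]
      rw [Finset.prod_mul_distrib, Finset.prod_const, (Finset.mem_powersetCard.1 hT).2]
    rw [this]
    ring

theorem BadEvent.bound_scale_le {w w' : L → Part → ℝ} {x : ℝ} (hx : 0 ≤ x) (hx1 : x ≤ 1)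
    (hw : ∀ ℓ p, 0 ≤ w ℓ p) (h : ∀ ℓ p, p ≠ 0 → w' ℓ p = x * w ℓ p) {B : BadEvent L} {m : ℕ}
    (hm : m ≤ B.order) : B.bound w' ≤ x ^ m * B.bound w := by
  rw [BadEvent.bound_scale h]
  exact mul_le_mul_of_nonneg_right (pow_le_pow_of_le_one hx hx1 hm) (B.bound_nonneg hw)

theorem countBound_scale_le {w w' : L → Part → ℝ} {x : ℝ} (hx : 0 ≤ x) (hx1 : x ≤ 1)
    (hw : ∀ ℓ p, 0 ≤ w ℓ p) (h0 : ∀ ℓ, w' ℓ 0 = w ℓ 0)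
    (h : ∀ ℓ p, p ≠ 0 → w' ℓ p = x * w ℓ p) (Bs : List (BadEvent L)) (A : (L → Part) → Prop) :
    countBound w' Bs A ≤ countBound w Bs A := by
  refine add_le_add ?_ (List.sum_le_sum fun B _ => ?_)
  · simpa using cfgSum_scale_le hx hx1 hw h0 h (m := 0) (A := fun f => Good Bs f ∧ A f)
      fun _ _ _ => Nat.zero_le _
  · simpa using BadEvent.bound_scale_le hx hx1 hw h (B := B) (Nat.zero_le _)

theorem countBound_nonneg {w : L → Part → ℝ} (hw : ∀ ℓ p, 0 ≤ w ℓ p) (Bs : List (BadEvent L))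
    (A : (L → Part) → Prop) : 0 ≤ countBound w Bs A := by
  refine add_nonneg (cfgSum_nonneg hw _) (List.sum_nonneg fun y hy => ?_)
  obtain ⟨B, -, rfl⟩ := List.mem_map.1 hy
  exact B.bound_nonneg hw

end Scaling

section Weights
variable {α : Mal → ℝ} {t x : ℝ}

theorem weight_zero (a : Axis) (κ : Kind) : weight α t a κ 0 = 1 := if_pos rfl

theorem weight_nonneg (hα : ∀ E, 0 < α E) (ht : 0 ≤ t) (a : Axis) (κ : Kind) (p : Part) :
    0 ≤ weight α t a κ p := by
  unfold weight
  split_ifs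
  · exact zero_le_one
  · refine Finset.sum_nonneg fun E _ => ?_
    split_ifs
    exacts [mul_nonneg (hα E).le ht, le_rfl]

theorem weight_mul {a : Axis} {κ : Kind} {p : Part} (hp : p ≠ 0) :
    weight α (x * t) a κ p = x * weight α t a κ p := by
  rw [weight, weight, if_neg hp, if_neg hp, Finset.mul_sum]
  refine Finset.sum_congr rfl fun E _ => ?_
  split_ifs
  · ring
  · simp

theorem canErr_of_weight_ne_zero {a : Axis} {κ : Kind} {p : Part}
    (h : weight α t a κ p ≠ 0) : CanErr a κ p := by
  by_contra hc
  simp only [CanErr, not_or, not_exists] at hc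
  rw [weight, if_neg hc.1] at h
  exact h (Finset.sum_eq_zero fun E _ => if_neg (hc.2 E))

theorem noFail_nonneg (p : Part) : 0 ≤ noFail p := by
  unfold noFail; split_ifs <;> norm_num

theorem noFail_zero : noFail 0 = 1 := if_pos rfl

theorem noFail_of_ne {p : Part} (hp : p ≠ 0) : noFail p = 0 := if_neg hp

end Weights

/-! ### Acceptance and level-two bounds under a reduction of the noise strength. -/

section Bounds
variable {S : Scheme} {cuts : Cutoffs S} {α : Mal → ℝ} {t x : ℝ}

theorem ancWeight_pair_nonneg (hα : ∀ E, 0 < α E) (ht : 0 ≤ t) (b : Axis) (s : Fin 2)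
    (ℓ : AncLoc S) (p : Part) :
    0 ≤ (if ℓ.pairLocs s then ancWeight α t b b ℓ else noFail) p := by
  split_ifs
  exacts [weight_nonneg hα ht _ _ _, noFail_nonneg p]

theorem accept₁_mul_le (hα : ∀ E, 0 < α E) (ht : 0 ≤ t) (hx : 0 ≤ x) (hx1 : x ≤ 1) (b : Axis)
    (s : Fin 2) : accept₁ cuts α t b s ≤ accept₁ cuts α (x * t) b s := by
  refine sub_le_sub_left (countBound_scale_le hx hx1 (ancWeight_pair_nonneg hα ht b s) ?_ ?_ _ _) _
  · intro ℓ
    split_ifs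
    · simp [ancWeight, weight_zero]
    · rfl
  · intro ℓ p hp
    split_ifs
    · exact weight_mul hp
    · simp [noFail_of_ne hp]

/-- The subtracted quotient falls for two reasons: its numerator counts weights that shrink, and its
denominator, the acceptance of the first checks, grows. -/
theorem accept₂_mul_le (hα : ∀ E, 0 < α E) (ht : 0 ≤ t) (hx : 0 ≤ x) (hx1 : x ≤ 1) (b : Axis)
    (hA : ∀ s, 0 < accept₁ cuts α t b s) : accept₂ cuts α t b ≤ accept₂ cuts α (x * t) b := by
  refine sub_le_sub_left (div_le_div₀ (countBound_nonneg (fun ℓ p => weight_nonneg hα ht _ _ _) _ _)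
    (countBound_scale_le hx hx1 (fun ℓ p => weight_nonneg hα ht _ _ _) ?_ ?_ _ _)
    (mul_pos (hA 0) (hA 1))
    (mul_le_mul (accept₁_mul_le hα ht hx hx1 b 0) (accept₁_mul_le hα ht hx hx1 b 1) (hA 1).le
      ((hA 0).le.trans (accept₁_mul_le hα ht hx hx1 b 0)))) _
  · intro ℓ
    simp [ancWeight, weight_zero]
  · intro ℓ p hp
    exact weight_mul hp

theorem AcceptPos.mul (hα : ∀ E, 0 < α E) (ht : 0 ≤ t) (hx : 0 ≤ x) (hx1 : x ≤ 1)
    (h : AcceptPos cuts α t) : AcceptPos cuts α (x * t) := fun b =>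
  ⟨fun s => ((h b).1 s).trans_le (accept₁_mul_le hα ht hx hx1 b s),
    (h b).2.trans_le (accept₂_mul_le hα ht hx hx1 b (h b).1)⟩

theorem AcceptPos.acceptBound_pos (h : AcceptPos cuts α t) (b : Axis) :
    0 < acceptBound cuts α t b :=
  mul_pos (mul_pos ((h b).1 0) ((h b).1 1)) (h b).2

theorem acceptBound_mul_le (hα : ∀ E, 0 < α E) (ht : 0 ≤ t) (hx : 0 ≤ x) (hx1 : x ≤ 1)
    (h : AcceptPos cuts α t) (b : Axis) :
    acceptBound cuts α t b ≤ acceptBound cuts α (x * t) b := by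
  have h' := h.mul hα ht hx hx1
  refine mul_le_mul (mul_le_mul (accept₁_mul_le hα ht hx hx1 b 0) (accept₁_mul_le hα ht hx hx1 b 1)
    ((h b).1 1).le ((h' b).1 0).le) (accept₂_mul_le hα ht hx hx1 b (h b).1) (h b).2.le
    (mul_pos ((h' b).1 0) ((h' b).1 1)).le

theorem AcceptPos.acceptAll_pos (h : AcceptPos cuts α t) (κ : Kind) (v : Variant)
    (T : AncIx → Prop) : 0 < acceptAll cuts α t κ v T := by
  refine Finset.prod_pos fun y _ => ?_
  split_ifs
  · cases ancAt κ v y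
    exacts [zero_lt_one, h.acceptBound_pos _]
  · exact zero_lt_one

theorem acceptAll_mul_le (hα : ∀ E, 0 < α E) (ht : 0 ≤ t) (hx : 0 ≤ x) (hx1 : x ≤ 1)
    (h : AcceptPos cuts α t) (κ : Kind) (v : Variant) (T : AncIx → Prop) :
    acceptAll cuts α t κ v T ≤ acceptAll cuts α (x * t) κ v T := by
  refine Finset.prod_le_prod (fun y _ => ?_) fun y _ => ?_
  · split_ifs
    · cases ancAt κ v y
      exacts [zero_le_one, (h.acceptBound_pos _).le]
    · exact zero_le_one
  · split_ifs
    · cases ancAt κ v y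
      exacts [le_rfl, acceptBound_mul_le hα ht hx hx1 h _]
    · exact le_rfl

theorem exWeight_nonneg (hα : ∀ E, 0 < α E) (ht : 0 ≤ t) (κ : Kind) (v : Variant) (a : Axis)
    (ℓ : ExLoc S) (p : Part) : 0 ≤ exWeight α t κ v a ℓ p := by
  unfold exWeight
  cases kindAt κ v ℓ
  exacts [noFail_nonneg p, weight_nonneg hα ht _ _ _]

theorem exWeight_zero (κ : Kind) (v : Variant) (a : Axis) (ℓ : ExLoc S) :
    exWeight α t κ v a ℓ 0 = 1 := by
  unfold exWeight
  cases kindAt κ v ℓ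
  exacts [noFail_zero, weight_zero _ _]

theorem exWeight_mul (κ : Kind) (v : Variant) (a : Axis) (ℓ : ExLoc S) {p : Part} (hp : p ≠ 0) :
    exWeight α (x * t) κ v a ℓ p = x * exWeight α t κ v a ℓ p := by
  unfold exWeight
  cases kindAt κ v ℓ
  · simp [noFail_of_ne hp]
  · exact weight_mul hp

theorem canErrAt_of_exWeight_ne_zero {κ : Kind} {v : Variant} {a : Axis} {f : ExLoc S → Part}
    (h : ∀ ℓ, exWeight α t κ v a ℓ (f ℓ) ≠ 0) : CanErrAt κ v a f := by
  intro ℓ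
  have := h ℓ
  unfold exWeight at this
  cases hk : kindAt κ v ℓ <;> rw [hk] at this
  · by_contra hf
    exact this (noFail_of_ne hf)
  · exact canErr_of_weight_ne_zero this

theorem Mal.err_ne_zero (E : Mal) : E.err ≠ 0 := by cases E <;> decide

/-- The counting bound decreases at least like the power of the noise strength that is the least
number of failures of a bad event, up to the fourth power. -/
theorem variantBound_mul_le (hft : StrictlyFaultTolerant S) (hα : ∀ E, 0 < α E) (ht : 0 ≤ t)
    (hx : 0 ≤ x) (hx1 : x ≤ 1) (h : AcceptPos cuts α t) {m : ℕ} (hm4 : m ≤ 4)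
    (hm : ∀ κ v a, ∀ B ∈ cuts.exRec κ v a, m ≤ B.order) (E : Mal) (v : Variant) :
    variantBound cuts α E v (x * t) ≤ x ^ m * variantBound cuts α E v t := by
  have hw := exWeight_nonneg (S := S) hα ht E.kind v E.axis
  have hw' := exWeight_nonneg (S := S) hα (mul_nonneg hx ht) E.kind v E.axis
  unfold variantBound
  dsimp only
  rw [mul_add]
  refine add_le_add ?_ ?_
  · rw [← mul_div_assoc]
    refine div_le_div₀ (mul_nonneg (pow_nonneg hx _) (cfgSum_nonneg hw _)) ?_
      (h.acceptAll_pos _ _ _) (acceptAll_mul_le hα ht hx hx1 h _ _ _)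
    refine cfgSum_scale_le hx hx1 hw (fun ℓ => ?_) (fun ℓ p hp => exWeight_mul _ _ _ _ hp) ?_
    · rw [exWeight_zero, exWeight_zero]
    -- Fault tolerance enters here, and the restriction `m ≤ 4` comes from it: with fewer than four
    -- failures the logical error would vanish, whereas that of `E` is nonzero.
    · rintro f ⟨-, hacc, hE⟩ hf
      by_contra hlt
      exact E.err_ne_zero (hE ▸ logical_eq_zero hft (canErrAt_of_exWeight_ne_zero hf) hacc
        (by omega))
  · rw [← List.sum_map_mul_left]
    refine List.sum_le_sum fun B hB => ?_
    rw [← mul_div_assoc]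
    exact div_le_div₀ (mul_nonneg (pow_nonneg hx _) (B.bound_nonneg hw))
      (BadEvent.bound_scale_le hx hx1 hw (fun ℓ p hp => exWeight_mul _ _ _ _ hp) (hm _ _ _ B hB))
      (h.acceptAll_pos _ _ _) (acceptAll_mul_le hα ht hx hx1 h _ _ _)

theorem levelTwoBound_mul_le (hft : StrictlyFaultTolerant S) (hα : ∀ E, 0 < α E) (ht : 0 ≤ t)
    (hx : 0 ≤ x) (hx1 : x ≤ 1) (h : AcceptPos cuts α t) {m : ℕ} (hm4 : m ≤ 4)
    (hm : ∀ κ v a, ∀ B ∈ cuts.exRec κ v a, m ≤ B.order) (E : Mal) :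
    levelTwoBound cuts α E (x * t) ≤ x ^ m * levelTwoBound cuts α E t := by
  refine Finset.sup'_le _ _ fun v hv => ?_
  refine (variantBound_mul_le hft hα ht hx hx1 h hm4 hm E v).trans
    (mul_le_mul_of_nonneg_left ?_ (pow_nonneg hx m))
  exact Finset.le_sup' (fun v => variantBound cuts α E v t) hv

end Bounds

/-! ### Probabilities of acceptance -/

/-- A probability vector. -/
def IsLaw {β : Type} [Fintype β] (μ : β → ℝ) : Prop := (∀ b, 0 ≤ μ b) ∧ ∑ b, μ b = 1

/-- The law of the part of type `a` of a random error. -/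
noncomputable def marginal (a : Axis) (μ : Err → ℝ) : Part → ℝ := mapLaw (fun e : Err => e a) μ

/-- The error law of a location of kind `κ` is bounded by the transformed noise model. -/
def IsBounded (α : Mal → ℝ) (t : ℝ) (κ : Kind) (μ : Err → ℝ) : Prop :=
  IsLaw μ ∧ ∀ a p, marginal a μ p ≤ weight α t a κ p

theorem IsLaw.marginal {μ : Err → ℝ} (h : IsLaw μ) (a : Axis) : IsLaw (marginal a μ) :=
  ⟨mapLaw_nonneg h.1, (sum_mapLaw _ μ).trans h.2⟩

theorem IsLaw.le_one {β : Type} [Fintype β] {μ : β → ℝ} (h : IsLaw μ) (b : β) : μ b ≤ 1 :=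
  h.2 ▸ Finset.single_le_sum (fun b _ => h.1 b) (Finset.mem_univ b)

theorem isLaw_noErr : IsLaw noErr := by
  refine ⟨fun e => ?_, by simp [noErr]⟩
  unfold noErr
  split_ifs <;> norm_num

theorem isLaw_noFail : IsLaw noFail := ⟨noFail_nonneg, by simp [noFail]⟩

theorem marginal_noErr (a : Axis) : marginal a noErr = noFail := by
  funext p
  rw [marginal, mapLaw, Finset.sum_eq_single 0]
  · simp [noErr, noFail, eq_comm]
  · intro e _ he
    simp [noErr, he]
  · simp

/-! ### Acceptance in the absence of failures. -/

section NoError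
variable {S : Scheme}

theorem prepOut_zero (a : Axis) (i : Fin 4) : prepOut a (0 : AncLoc S → Part) i = 0 := by
  have hstep : ∀ g : PGate, g.step a 0 0 = 0 := fun g => by
    cases g with
    | cnot i j h => cases a <;> simp [PGate.step, cnotProp]
    | rest i => simp [PGate.step]
  have hfold : ∀ l : List (Fin (S i).gates.length),
      l.foldl (fun v n => ((S i).gates.get n).step a v 0) (0 : Blk) = 0 := fun l => by
    induction l with
    | nil => rfl
    | cons n l ih => rw [List.foldl_cons, hstep, ih]
  exact hfold _

/-- Needed twice: absent ancillas are accepted with certainty, and at the physical level acceptance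
has positive probability. -/
theorem ancAcc_zero (b a : Axis) : ancAcc b a (0 : AncLoc S → Part) := by
  have h0 : orient b (0 : AncLoc S → Part) = 0 := by
    funext ℓ
    simp only [orient]
    split_ifs <;> rfl
  have hp : ∀ s, pairOut .Z (0 : AncLoc S → Part) s = 0 := fun s => by
    funext q
    simp [pairOut, prepOut_zero, cnotProp]
  rw [ancAcc, h0]
  cases role b a with
  | X =>
    intro s
    have : check₁ (0 : AncLoc S → Part) s = 0 := by
      funext q
      simp [check₁, prepOut_zero]
    rw [this]
    exact stab.zero_mem
  | Z =>
    have : check₂ (0 : AncLoc S → Part) = 0 := by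
      funext q
      simp [check₂, hp]
    simp only [zeroAcc, this]
    exact zero_mem_code

theorem accepted_zero (κ : Kind) : accepted κ (0 : ExLoc S → Err) := fun a =>
  ⟨fun _ b => ancAcc_zero b a, fun _ b => ancAcc_zero b a, fun b _ => ancAcc_zero b a⟩

theorem cfgSum_noErr {L : Type} [Fintype L] {ν : L → Err → ℝ} (hν : ∀ ℓ, ν ℓ = noErr)
    {A : (L → Err) → Prop} (hA : A 0) : 1 ≤ cfgSum ν A := by
  have hν0 : ∀ ℓ e, 0 ≤ ν ℓ e := fun ℓ e => by rw [hν]; exact isLaw_noErr.1 e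
  have := Finset.single_le_sum (f := fun f : L → Err => if A f then ∏ ℓ, ν ℓ (f ℓ) else 0)
    (fun f _ => by
      split_ifs
      exacts [Finset.prod_nonneg fun ℓ _ => hν0 ℓ _, le_rfl]) (Finset.mem_univ 0)
  have h1 : (if A 0 then ∏ ℓ, ν ℓ ((0 : L → Err) ℓ) else 0) = 1 := by simp [hA, hν, noErr]
  rw [← h1]
  exact this

end NoError

/-! ### Acceptance probability of one verified ancilla. -/

section Ancilla
variable {S : Scheme} {cuts : Cutoffs S} {α : Mal → ℝ} {t : ℝ} {b : Axis}
  {ν : AncLoc S → Err → ℝ}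

theorem dependsOn_check₁ (b : Axis) (s : Fin 2) :
    DependsOn (fun f : AncLoc S → Part => check₁ (orient b f) s ∈ stab)
      {ℓ : AncLoc S | ℓ.pairLocs s} := by
  intro f g hfg
  have ho : ∀ ℓ : AncLoc S, ℓ.pairLocs s → orient b f ℓ = orient b g ℓ := fun ℓ hℓ => by
    simp only [orient, hfg ℓ hℓ]
  have hp : ∀ i : Fin 4, i.val / 2 = s.val →
      prepOut .X (orient b f) i = prepOut .X (orient b g) i := fun i hi => by
    unfold prepOut
    congr 1
    · funext q
      rw [ho (.prep i q) hi]
    · funext n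
      rw [ho (.gate i n) hi]
  have hc : check₁ (orient b f) s = check₁ (orient b g) s := by
    funext q
    simp only [check₁]
    rw [hp (fst s) (by simp [fst]), hp (snd s) (by simp only [snd]; omega), ho (.cnot₁ s q) rfl,
      ho (.meas₁ s q) rfl]
  simp only [hc]

theorem forall_ancAcc_iff (b : Axis) (f : AncLoc S → Err) :
    (∀ a, ancAcc b a (fun ℓ => f ℓ a)) ↔
      ((check₁ (orient b fun ℓ => f ℓ b) 0 ∈ stab ∧ check₁ (orient b fun ℓ => f ℓ b) 1 ∈ stab) ∧
        check₂ (orient b fun ℓ => f ℓ b.other) ∈ code) := by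
  have hs : ∀ P : Fin 2 → Prop, (∀ s, P s) ↔ P 0 ∧ P 1 := fun P => Fin.forall_fin_two
  have ha : ∀ P : Axis → Prop, (∀ a, P a) ↔ P b ∧ P b.other := fun P => by
    refine ⟨fun h => ⟨h _, h _⟩, fun h a => ?_⟩
    cases a <;> cases b <;> first | exact h.1 | exact h.2
  rw [ha]
  cases b <;> simp only [ancAcc, zeroAcc, role, Axis.other, hs]

/-- Counting bounds the rejections. The check sees only the locations of its pair, so the other laws
may be replaced by `noFail`; this keeps their weights, whose totals may exceed one, out of the
count. -/
theorem accept₁_le (hν : ∀ ℓ, IsBounded α t (ℓ.kind b) (ν ℓ)) (s : Fin 2) :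
    accept₁ cuts α t b s ≤
      cfgSum ν (fun f : AncLoc S → Err => check₁ (orient b fun ℓ => f ℓ b) s ∈ stab) := by
  have h1 := cfgSum_add_cfgSum_not (fun ℓ => (hν ℓ).1.2)
    (fun f : AncLoc S → Err => check₁ (orient b fun ℓ => f ℓ b) s ∈ stab)
  have hlaw : ∀ ℓ : AncLoc S, IsLaw (if ℓ.pairLocs s then marginal b (ν ℓ) else noFail) :=
    fun ℓ => by
      split_ifs
      exacts [(hν ℓ).1.marginal b, isLaw_noFail]
  have h2 : cfgSum ν (fun f : AncLoc S → Err => ¬ check₁ (orient b fun ℓ => f ℓ b) s ∈ stab) =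
      cfgSum (fun ℓ => if ℓ.pairLocs s then marginal b (ν ℓ) else noFail)
        (fun f => check₁ (orient b f) s ∉ stab) := by
    rw [cfgSum_map ν (fun e : Err => e b) (fun f => check₁ (orient b f) s ∉ stab)]
    refine cfgSum_eq_of_dependsOn (s := {ℓ : AncLoc S | ℓ.pairLocs s})
      (fun ℓ => ((hν ℓ).1.marginal b).2) (fun ℓ => (hlaw ℓ).2) ?_ ?_
    · intro f g hfg
      exact congrArg Not (dependsOn_check₁ b s hfg)
    · intro ℓ hℓ
      exact (if_pos hℓ).symm
  have h3 := cfgSum_le_countBound (fun ℓ => (hlaw ℓ).1) (fun ℓ => (hlaw ℓ).2)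
    (w := fun ℓ => if ℓ.pairLocs s then ancWeight α t b b ℓ else noFail) (fun ℓ p => by
      split_ifs
      exacts [(hν ℓ).2 b p, le_rfl]) (cuts.disjoint₁ b s) (fun f => check₁ (orient b f) s ∉ stab)
  rw [accept₁]
  linarith

theorem acceptBound_le (hA : AcceptPos cuts α t) (hν : ∀ ℓ, IsBounded α t (ℓ.kind b) (ν ℓ)) :
    acceptBound cuts α t b ≤
      cfgSum ν (fun f : AncLoc S → Err => ∀ a, ancAcc b a (fun ℓ => f ℓ a)) := by
  have hν0 : ∀ ℓ e, 0 ≤ ν ℓ e := fun ℓ => (hν ℓ).1.1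
  have hν1 : ∀ ℓ, ∑ e, ν ℓ e = 1 := fun ℓ => (hν ℓ).1.2
  rw [cfgSum_congr (forall_ancAcc_iff b)]
  have hdep : ∀ s, DependsOn
      (fun f : AncLoc S → Err => check₁ (orient b fun ℓ => f ℓ b) s ∈ stab)
      {ℓ : AncLoc S | ℓ.pairLocs s} := fun s f g hfg =>
    dependsOn_check₁ b s fun ℓ hℓ => congrFun (hfg ℓ hℓ) b
  have hdisj : {ℓ : AncLoc S | ℓ.pairLocs 1} ⊆ {ℓ : AncLoc S | ℓ.pairLocs 0}ᶜ := by
    intro ℓ h1 h0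
    change ℓ.pairLocs 1 at h1
    change ℓ.pairLocs 0 at h0
    rcases ℓ with ⟨i, q⟩ | ⟨i, n⟩ | ⟨s, q⟩ | ⟨s, q⟩ | _ | _ | _ <;>
      simp_all [AncLoc.pairLocs]
  have hand := cfgSum_and_of_dependsOn hν1 (hdep 0) ((hdep 1).mono hdisj)
  have hrej : cfgSum ν (fun f : AncLoc S → Err =>
      check₂ (orient b fun ℓ => f ℓ b.other) ∉ code) ≤
      countBound (ancWeight α t b b.other) (cuts.verify₂ b)
        (fun f => check₂ (orient b f) ∉ code) := by
    rw [cfgSum_map ν (fun e : Err => e b.other) (fun f => check₂ (orient b f) ∉ code)]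
    exact cfgSum_le_countBound (fun ℓ => ((hν ℓ).1.marginal b.other).1)
      (fun ℓ => ((hν ℓ).1.marginal b.other).2) (fun ℓ p => (hν ℓ).2 b.other p)
      (cuts.disjoint₂ b) _
  have hor := (cfgSum_mono hν0 (A := fun f : AncLoc S → Err =>
      check₁ (orient b fun ℓ => f ℓ b) 0 ∈ stab ∧ check₁ (orient b fun ℓ => f ℓ b) 1 ∈ stab)
    (B := fun f => ((check₁ (orient b fun ℓ => f ℓ b) 0 ∈ stab ∧
      check₁ (orient b fun ℓ => f ℓ b) 1 ∈ stab) ∧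
        check₂ (orient b fun ℓ => f ℓ b.other) ∈ code) ∨
        check₂ (orient b fun ℓ => f ℓ b.other) ∉ code) (fun f hf => (em _).imp (⟨hf, ·⟩) id)).trans
    (cfgSum_or_le hν0 _ _)
  have hpos : 0 < accept₁ cuts α t b 0 * accept₁ cuts α t b 1 :=
    mul_pos ((hA b).1 0) ((hA b).1 1)
  have hmul := mul_le_mul (accept₁_le (cuts := cuts) hν 0) (accept₁_le (cuts := cuts) hν 1)
    ((hA b).1 1).le (cfgSum_nonneg hν0 _)
  -- The factors `accept₁` cancel the denominator in `accept₂`: the bound is their product minus the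
  -- unconditional bound for rejection by the second check.
  rw [acceptBound, accept₂, mul_sub, mul_one, mul_div_cancel₀ _ hpos.ne']
  linarith

end Ancilla

/-! ### The counting bound holds -/

section ExRec
variable {S : Scheme} {cuts : Cutoffs S} {α : Mal → ℝ} {t : ℝ} {κ : Kind} {v : Variant}
  {ν : ExLoc S → Err → ℝ}

/-- Acceptance of one of the ancillas of an extended rectangle. -/
def ancillaAcc (κ : Kind) (x : AncIx) (f : ExLoc S → Err) : Prop :=
  match x with
  | .inl (i, b) => ∀ a, ancAcc b a (fun ℓ => f (.lec i (.anc b ℓ)) a)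
  | .inr (.inl (i, b)) => ∀ a, ancAcc b a (fun ℓ => f (.tec i (.anc b ℓ)) a)
  | .inr (.inr _) => ∀ b, κ = .prep b → ∀ a, ancAcc b a (fun ℓ => f (.anc ℓ) a)

theorem accepted_iff (f : ExLoc S → Err) : accepted κ f ↔ ∀ x, ancillaAcc κ x f := by
  constructor
  · rintro h (⟨i, b⟩ | ⟨i, b⟩ | _)
    · exact fun a => (h a).1 i b
    · exact fun a => (h a).2.1 i b
    · exact fun b hb a => (h a).2.2 b hb
  · intro h a
    exact ⟨fun i b => h (.inl (i, b)) a, fun i b => h (.inr (.inl (i, b))) a,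
      fun b hb => h (.inr (.inr ())) b hb a⟩

theorem dependsOn_ancillaAcc (κ : Kind) (x : AncIx) :
    DependsOn (ancillaAcc (S := S) κ x) {ℓ | ancOf ℓ = some x} := by
  intro f g hfg
  rcases x with ⟨i, b⟩ | ⟨i, b⟩ | _
  · have : ∀ ℓ, f (.lec i (.anc b ℓ)) = g (.lec i (.anc b ℓ)) := fun ℓ => hfg _ rfl
    simp only [ancillaAcc, this]
  · have : ∀ ℓ, f (.tec i (.anc b ℓ)) = g (.tec i (.anc b ℓ)) := fun ℓ => hfg _ rfl
    simp only [ancillaAcc, this]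
  · have : ∀ ℓ, f (.anc ℓ) = g (.anc ℓ) := fun ℓ => hfg _ rfl
    simp only [ancillaAcc, this]

/-- The error laws of the locations of an extended rectangle are bounded by the transformed noise
model. -/
def ExBounded (α : Mal → ℝ) (t : ℝ) (κ : Kind) (v : Variant) (ν : ExLoc S → Err → ℝ) : Prop :=
  ∀ ℓ, match kindAt κ v ℓ with
    | some κ' => IsBounded α t κ' (ν ℓ)
    | none => ν ℓ = noErr

theorem ExBounded.isLaw (h : ExBounded α t κ v ν) (ℓ : ExLoc S) : IsLaw (ν ℓ) := by
  have := h ℓ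
  cases hk : kindAt κ v ℓ <;> rw [hk] at this
  · rw [show ν ℓ = noErr from this]
    exact isLaw_noErr
  · exact this.1

theorem ExBounded.marginal_le (h : ExBounded α t κ v ν) (a : Axis) (ℓ : ExLoc S) (p : Part) :
    marginal a (ν ℓ) p ≤ exWeight α t κ v a ℓ p := by
  have := h ℓ
  unfold exWeight
  cases hk : kindAt κ v ℓ <;> rw [hk] at this
  · rw [show ν ℓ = noErr from this, marginal_noErr]
  · exact this.2 a p

theorem acceptBound_le_cfgSum_comp (hA : AcceptPos cuts α t) (h : ExBounded α t κ v ν)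
    {b : Axis} {j : AncLoc S → ExLoc S} (hj : Function.Injective j)
    (hk : ∀ ℓ, kindAt κ v (j ℓ) = some (ℓ.kind b)) :
    acceptBound cuts α t b ≤ cfgSum ν (fun f => ∀ a, ancAcc b a (fun ℓ => f (j ℓ) a)) := by
  rw [cfgSum_comp_injective (fun ℓ => (h.isLaw ℓ).2) hj
    (fun f : AncLoc S → Err => ∀ a, ancAcc b a (fun ℓ => f ℓ a))]
  refine acceptBound_le hA fun ℓ => ?_
  have := h (j ℓ)
  rw [hk ℓ] at this
  exact this

theorem one_le_cfgSum_comp (h : ExBounded α t κ v ν)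
    (b : Axis) {j : AncLoc S → ExLoc S} (hj : Function.Injective j)
    (hk : ∀ ℓ, kindAt κ v (j ℓ) = none) :
    1 ≤ cfgSum ν (fun f => ∀ a, ancAcc b a (fun ℓ => f (j ℓ) a)) := by
  rw [cfgSum_comp_injective (fun ℓ => (h.isLaw ℓ).2) hj
    (fun f : AncLoc S → Err => ∀ a, ancAcc b a (fun ℓ => f ℓ a))]
  refine cfgSum_noErr (fun ℓ => ?_) fun a => ancAcc_zero b a
  have := h (j ℓ)
  rw [hk ℓ] at this
  exact this

theorem ancAt_le_cfgSum (hA : AcceptPos cuts α t) (h : ExBounded α t κ v ν) (x : AncIx) :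
    (match ancAt κ v x with
      | some b => acceptBound cuts α t b
      | none => 1) ≤ cfgSum ν (ancillaAcc κ x) := by
  rcases x with ⟨i, b⟩ | ⟨i, b⟩ | _
  · have hj : Function.Injective (fun ℓ : AncLoc S => ExLoc.lec i (.anc b ℓ)) :=
      fun ℓ ℓ' h => by simpa using h
    by_cases hi : lecOn κ i
    · simp only [ancAt, hi, if_true]
      exact acceptBound_le_cfgSum_comp hA h hj fun ℓ => by simp [kindAt, hi, ECLoc.kind]
    · simp only [ancAt, hi]
      exact one_le_cfgSum_comp h b hj fun ℓ => by simp [kindAt, hi]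
  · have hj : Function.Injective (fun ℓ : AncLoc S => ExLoc.tec i (.anc b ℓ)) :=
      fun ℓ ℓ' h => by simpa using h
    by_cases hi : tecOn κ v i
    · simp only [ancAt, hi, if_true]
      exact acceptBound_le_cfgSum_comp hA h hj fun ℓ => by simp [kindAt, hi, ECLoc.kind]
    · simp only [ancAt, hi]
      exact one_le_cfgSum_comp h b hj fun ℓ => by simp [kindAt, hi]
  · have h1 : (∀ b, κ ≠ .prep b) → 1 ≤ cfgSum ν (ancillaAcc κ (.inr (.inr ()))) := fun hκ =>
      (cfgSum_true (fun ℓ => (h.isLaw ℓ).2) fun f b hb => absurd hb (hκ b)).ge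
    have hj : Function.Injective (fun ℓ : AncLoc S => ExLoc.anc ℓ) :=
      fun ℓ ℓ' h => by simpa using h
    cases κ with
    | cnot => exact h1 (by simp)
    | rest => exact h1 (by simp)
    | meas b => exact h1 (by simp)
    | prep b =>
      refine (acceptBound_le_cfgSum_comp hA h hj fun ℓ => rfl).trans (cfgSum_mono
        (fun ℓ => (h.isLaw ℓ).1) ?_)
      intro f hf b' hb'
      cases hb'
      exact hf

/-- Each location belongs to at most one ancilla, so acceptances of different ancillas are
independent and their bounds multiply. -/
theorem acceptAll_le (hA : AcceptPos cuts α t) (h : ExBounded α t κ v ν) (T : AncIx → Prop) :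
    acceptAll cuts α t κ v T ≤
      cfgSum ν (fun f => ∀ x ∈ Finset.univ.filter T, ancillaAcc κ x f) := by
  rw [cfgSum_forall_mem_of_dependsOn (fun ℓ => (h.isLaw ℓ).2) ancOf _ (dependsOn_ancillaAcc κ),
    acceptAll, ← Finset.prod_filter]
  refine Finset.prod_le_prod (fun x _ => ?_) fun x _ => ancAt_le_cfgSum hA h x
  cases ancAt κ v x
  exacts [zero_le_one, (hA.acceptBound_pos _).le]

theorem acceptAll_true_le (hA : AcceptPos cuts α t) (h : ExBounded α t κ v ν) :
    acceptAll cuts α t κ v (fun _ => True) ≤ cfgSum ν (accepted κ) :=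
  (acceptAll_le hA h _).trans_eq (cfgSum_congr fun f => by simp [accepted_iff])

/-- Acceptance of the ancillas that `B` does not meet is independent of `B` and appears equally in
numerator and denominator. For those that it meets, acceptance is dropped from the numerator and
bounded below in the denominator. -/
theorem cfgSum_occurs_and_accepted_div_le (hα : ∀ E, 0 < α E) (ht : 0 ≤ t)
    (hA : AcceptPos cuts α t) (h : ExBounded α t κ v ν)
    (a : Axis) {B : BadEvent (ExLoc S)} (hB : B.IsDisjoint) :
    cfgSum ν (fun f => B.Occurs (fun ℓ => f ℓ a) ∧ accepted κ f) / cfgSum ν (accepted κ) ≤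
      B.bound (exWeight α t κ v a) /
        acceptAll cuts α t κ v (fun x => ∃ y ∈ B, ∃ ℓ ∈ y.1, ancOf ℓ = some x) := by
  obtain ⟨T, hT⟩ : ∃ T : AncIx → Prop, T = fun x => ∃ y ∈ B, ∃ ℓ ∈ y.1, ancOf ℓ = some x :=
    ⟨_, rfl⟩
  rw [← hT]
  have hν0 : ∀ ℓ e, 0 ≤ ν ℓ e := fun ℓ => (h.isLaw ℓ).1
  have hν1 : ∀ ℓ, ∑ e, ν ℓ e = 1 := fun ℓ => (h.isLaw ℓ).2
  have hprod := cfgSum_forall_mem_of_dependsOn hν1 ancOf _ (dependsOn_ancillaAcc (S := S) κ)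
  have hZ : cfgSum ν (accepted κ) =
      cfgSum ν (fun f => ∀ x ∈ Finset.univ.filter T, ancillaAcc κ x f) *
      cfgSum ν (fun f => ∀ x ∈ Finset.univ.filter (fun x => ¬ T x), ancillaAcc κ x f) := by
    rw [hprod, hprod, Finset.prod_filter_mul_prod_filter_not, ← hprod]
    exact cfgSum_congr fun f => by simp [accepted_iff]
  have hN : cfgSum ν (fun f => B.Occurs (fun ℓ => f ℓ a) ∧ accepted κ f) ≤
      cfgSum ν (fun f => B.Occurs (fun ℓ => f ℓ a)) *
      cfgSum ν (fun f => ∀ x ∈ Finset.univ.filter (fun x => ¬ T x), ancillaAcc κ x f) := by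
    rw [← cfgSum_and_of_dependsOn hν1 (s := {ℓ | ∃ x ∈ B, ℓ ∈ x.1})]
    · exact cfgSum_mono hν0 fun f hf => ⟨hf.1, fun x _ => (accepted_iff f).1 hf.2 x⟩
    · exact fun f g hfg => B.dependsOn_occurs fun ℓ hℓ => congrFun (hfg ℓ hℓ) a
    · intro f g hfg
      refine propext (forall₂_congr fun x hx => iff_of_eq ?_)
      refine dependsOn_ancillaAcc κ x fun ℓ hℓ => hfg ℓ ?_
      rintro ⟨y, hy, hℓy⟩
      exact (Finset.mem_filter.1 hx).2 (hT ▸ ⟨y, hy, ℓ, hℓy, hℓ⟩)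
  have hp := (hA.acceptAll_pos κ v T).trans_le (acceptAll_le hA h T)
  have hq := right_ne_zero_of_mul (hZ ▸ ((hA.acceptAll_pos κ v (fun _ => True)).trans_le
    (acceptAll_true_le hA h)).ne')
  have hocc : cfgSum ν (fun f => B.Occurs (fun ℓ => f ℓ a)) ≤ B.bound (exWeight α t κ v a) := by
    rw [cfgSum_map ν (fun e : Err => e a) B.Occurs]
    exact B.cfgSum_occurs_le (fun ℓ => ((h.isLaw ℓ).marginal a).1)
      (fun ℓ => ((h.isLaw ℓ).marginal a).2) (h.marginal_le a) hB
  calc _ ≤ (cfgSum ν (fun f => B.Occurs (fun ℓ => f ℓ a)) *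
      cfgSum ν (fun f => ∀ x ∈ Finset.univ.filter (fun x => ¬ T x), ancillaAcc κ x f)) /
        cfgSum ν (accepted κ) :=
        div_le_div_of_nonneg_right hN (cfgSum_nonneg hν0 _)
    _ = cfgSum ν (fun f => B.Occurs (fun ℓ => f ℓ a)) /
        cfgSum ν (fun f => ∀ x ∈ Finset.univ.filter T, ancillaAcc κ x f) := by
        rw [hZ, mul_div_mul_right _ _ hq]
    _ ≤ _ := div_le_div₀ (B.bound_nonneg (exWeight_nonneg hα ht κ v a)) hocc
        (hA.acceptAll_pos κ v T) (acceptAll_le hA h T)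

theorem sum_cfgSum_eq {L β δ : Type} [Fintype L] [Fintype β] [Fintype δ] (w : L → β → ℝ)
    (A : (L → β) → Prop) (ψ : (L → β) → δ) (φ : δ → Prop) :
    (∑ d, if φ d then cfgSum w (fun f => A f ∧ ψ f = d) else 0) =
      cfgSum w (fun f => A f ∧ φ (ψ f)) := by
  have : ∀ d, (if φ d then cfgSum w (fun f => A f ∧ ψ f = d) else 0) =
      ∑ f : L → β, if ψ f = d then (if A f ∧ φ (ψ f) then ∏ ℓ, w ℓ (f ℓ) else 0) else 0 :=
    fun d => by
      split_ifs with hd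
      · refine Finset.sum_congr rfl fun f _ => ?_
        by_cases h : ψ f = d
        · subst h; simp [hd]
        · simp [h]
      · refine (Finset.sum_eq_zero fun f _ => ?_).symm
        by_cases h : ψ f = d
        · subst h; simp [hd]
        · simp [h]
  simp only [this]
  rw [Finset.sum_comm, cfgSum]
  refine Finset.sum_congr rfl fun f _ => ?_
  rw [Finset.sum_ite_eq, if_pos (Finset.mem_univ _)]
  split_ifs <;> rfl

theorem exLaw_eq (e : Err) : exLaw κ v ν e =
    cfgSum ν (fun f => accepted κ f ∧ (fun a => logical κ v a (fun ℓ => f ℓ a)) = e) /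
      cfgSum ν (accepted κ) := by
  exact congrArg (· / cfgSum ν (accepted κ)) (cfgSum_congr fun f => and_congr_right' funext_iff.symm)

theorem isLaw_exLaw (hν : ∀ ℓ, IsLaw (ν ℓ)) (hZ : 0 < cfgSum ν (accepted κ)) :
    IsLaw (exLaw κ v ν) := by
  refine ⟨fun e => div_nonneg (cfgSum_nonneg (fun ℓ => (hν ℓ).1) _)
    (cfgSum_nonneg (fun ℓ => (hν ℓ).1) _), ?_⟩
  have := sum_cfgSum_eq ν (accepted κ) (fun f a => logical κ v a (fun ℓ => f ℓ a)) (fun _ => True)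
  simp only [if_true, and_true] at this
  simp only [exLaw_eq, ← Finset.sum_div]
  rw [this]
  exact div_self hZ.ne'

theorem marginal_exLaw (a : Axis) (p : Part) : marginal a (exLaw κ v ν) p =
    cfgSum ν (fun f => accepted κ f ∧ logical κ v a (fun ℓ => f ℓ a) = p) /
      cfgSum ν (accepted κ) := by
  have := sum_cfgSum_eq ν (accepted κ) (fun f a => logical κ v a (fun ℓ => f ℓ a))
    (fun e : Err => e a = p)
  rw [← this, Finset.sum_div, marginal, mapLaw]
  refine Finset.sum_congr rfl fun e _ => ?_
  rw [exLaw_eq]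
  split_ifs <;> simp

theorem malProb_eq (μ : Err → ℝ) (E : Mal) : malProb μ E = marginal E.axis μ E.err := by
  rw [malProb, marginal, mapLaw]
  refine Fintype.sum_congr _ _ fun e => ?_
  split_ifs <;> rfl

/-- Counting bounds the probability of a malignant event. -/
theorem malProb_exLaw_le (hα : ∀ E, 0 < α E) (ht : 0 ≤ t) (hA : AcceptPos cuts α t) {E : Mal}
    {ν : ExLoc S → Err → ℝ} (h : ExBounded α t E.kind v ν) :
    malProb (exLaw E.kind v ν) E ≤ levelTwoBound cuts α E t := by
  refine le_trans ?_ (Finset.le_sup' (fun v => variantBound cuts α E v t) (Finset.mem_univ v))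
  have hν0 : ∀ ℓ e, 0 ≤ ν ℓ e := fun ℓ => (h.isLaw ℓ).1
  have hZ := (hA.acceptAll_pos E.kind v (fun _ => True)).trans_le (acceptAll_true_le hA h)
  set Bs := cuts.exRec E.kind v E.axis with hBs
  -- For good configurations acceptance of the other error type is dropped, which leaves an event
  -- about one marginal. For bad events full acceptance is kept, so that its factors can cancel
  -- against the denominator.
  have hN : cfgSum ν (fun f => accepted E.kind f ∧
        logical E.kind v E.axis (fun ℓ => f ℓ E.axis) = E.err) ≤
      cfgSum ν (fun f => Good Bs (fun ℓ => f ℓ E.axis) ∧ accAxis E.kind E.axis (fun ℓ => f ℓ E.axis)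
        ∧ logical E.kind v E.axis (fun ℓ => f ℓ E.axis) = E.err) +
      (Bs.map fun B => cfgSum ν fun f =>
        B.Occurs (fun ℓ => f ℓ E.axis) ∧ accepted E.kind f).sum := by
    refine le_trans (cfgSum_mono hν0 fun f hf => ?_) ((cfgSum_or_le hν0 _
      (fun f => ∃ B ∈ Bs, B.Occurs (fun ℓ => f ℓ E.axis) ∧ accepted E.kind f)).trans
      (add_le_add_right (cfgSum_exists_list_le hν0 Bs
        (fun B f => B.Occurs (fun ℓ => f ℓ E.axis) ∧ accepted E.kind f)) _))
    by_cases hg : Good Bs (fun ℓ => f ℓ E.axis)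
    · exact .inl ⟨hg, hf.1 _, hf.2⟩
    · unfold Good at hg
      push Not at hg
      obtain ⟨B, hB, ho⟩ := hg
      exact .inr ⟨B, hB, ho, hf.1⟩
  rw [malProb_eq, marginal_exLaw]
  refine (div_le_div_of_nonneg_right hN hZ.le).trans ?_
  rw [add_div, variantBound]
  refine add_le_add ?_ ?_
  · refine div_le_div₀ (cfgSum_nonneg (exWeight_nonneg hα ht _ _ _) _) ?_
      (hA.acceptAll_pos _ _ _) (acceptAll_true_le hA h)
    rw [cfgSum_map ν (fun e : Err => e E.axis) (fun f => Good Bs f ∧ accAxis E.kind E.axis f ∧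
      logical E.kind v E.axis f = E.err)]
    exact cfgSum_mono_weight (fun ℓ => ((h.isLaw ℓ).marginal E.axis).1) (h.marginal_le E.axis) _
  · rw [div_eq_mul_inv, ← List.sum_map_mul_right]
    simp only [← div_eq_mul_inv]
    exact List.sum_le_sum fun B hB => cfgSum_occurs_and_accepted_div_le hα ht hA h E.axis
      (cuts.disjoint _ _ _ B hB)

end ExRec

/-! ### Depolarizing noise and the first level -/

theorem depol_nonneg {γ : ℝ} (h0 : 0 ≤ γ) (h1 : γ ≤ 1 / 15) (κ : Kind) (e : Err) :
    0 ≤ depol γ κ e := by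
  cases κ <;> simp only [depol] <;> split_ifs <;> linarith

theorem depol_zero_pos {γ : ℝ} (h1 : γ < 1 / 15) (κ : Kind) : 0 < depol γ κ 0 := by
  cases κ <;> simp only [depol, if_true] <;> linarith

theorem sum_err (F : Err → ℝ) : ∑ e, F e =
    ∑ x : ZMod 2 × ZMod 2, ∑ z : ZMod 2 × ZMod 2, F (fun a => match a with | .X => x | .Z => z) := by
  let φ : Err ≃ Part × Part :=
    { toFun := fun e => (e .X, e .Z)
      invFun := fun y a => match a with | .X => y.1 | .Z => y.2
      left_inv := fun e => by funext a; cases a <;> rfl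
      right_inv := fun y => rfl }
  rw [← Equiv.sum_comp φ.symm, Fintype.sum_prod_type]
  rfl

theorem isLaw_depol {γ : ℝ} (h0 : 0 ≤ γ) (h1 : γ ≤ 1 / 15) (κ : Kind) : IsLaw (depol γ κ) := by
  refine ⟨depol_nonneg h0 h1 κ, ?_⟩
  have hsum : ∀ F : ZMod 2 → ℝ, ∑ x, F x = F 0 + F 1 := fun F => Fin.sum_univ_two F
  have hax : ∀ P : Axis → Prop, (∀ a, P a) ↔ P .X ∧ P .Z :=
    fun P => ⟨fun h => ⟨h _, h _⟩, fun h a => by cases a; exacts [h.1, h.2]⟩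
  rw [sum_err]
  cases κ with
  | cnot =>
    simp [Fintype.sum_prod_type, hsum, depol, funext_iff, hax]
    ring
  | rest =>
    simp [Fintype.sum_prod_type, hsum, depol, funext_iff, hax]
    ring
  | prep b =>
    cases b <;> simp [Fintype.sum_prod_type, hsum, depol, funext_iff, hax]
  | meas b =>
    cases b <;> simp [Fintype.sum_prod_type, hsum, depol, funext_iff, hax]

/-! ### Bounded laws at level one and the passage to the next level. -/

section Levels
variable {S : Scheme} {cuts : Cutoffs S} {α : Mal → ℝ} {t γ : ℝ}

/-- All the error laws of the level-`k` locations are bounded by the transformed noise model. -/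
def LevelBounded (S : Scheme) (α : Mal → ℝ) (γ : ℝ) (k : ℕ) (t : ℝ) : Prop :=
  ∀ κ, ∀ μ ∈ level S γ k κ, IsBounded α t κ μ

/-- The twelve events exhaust the nontrivial logical errors of each type, so bounds on them bound
the whole marginal of a rectangle. -/
theorem canErr_logical (κ : Kind) (v : Variant) (a : Axis) (f : ExLoc S → Part) :
    CanErr a κ (logical κ v a f) := by
  have h2 : ∀ z : ZMod 2, z = 0 ∨ z = 1 := by decide
  have h1 : ∀ z : ZMod 2, CanErr a .rest (z, 0) := fun z => by
    rcases h2 z with rfl | rfl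
    · exact .inl rfl
    · cases a
      exacts [.inr ⟨.restX, rfl, rfl, rfl⟩, .inr ⟨.restZ, rfl, rfl, rfl⟩]
  cases κ with
  | cnot => exact canErr_cnot a _
  | rest => exact h1 _
  | prep b =>
    simp only [logical]
    split_ifs with hab
    · subst hab
      generalize D _ = z
      rcases h2 z with rfl | rfl
      · exact .inl rfl
      · cases a
        exacts [.inr ⟨.prepX, rfl, rfl, rfl⟩, .inr ⟨.prepZ, rfl, rfl, rfl⟩]
    · exact .inl rfl
  | meas b =>
    simp only [logical]
    split_ifs with hab
    · subst hab
      generalize D _ - D _ = z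
      rcases h2 z with rfl | rfl
      · exact .inl rfl
      · cases a
        exacts [.inr ⟨.measX, rfl, rfl, rfl⟩, .inr ⟨.measZ, rfl, rfl, rfl⟩]
    · exact .inl rfl

/-- Bounds on the malignant events of an extended rectangle give a transformed noise model. -/
theorem isBounded_exLaw (hα : ∀ E, 0 < α E) (ht : 0 ≤ t) {κ : Kind} {v : Variant}
    {ν : ExLoc S → Err → ℝ} (hlaw : IsLaw (exLaw κ v ν))
    (hmal : ∀ E : Mal, E.kind = κ → malProb (exLaw κ v ν) E ≤ α E * t) :
    IsBounded α t κ (exLaw κ v ν) := by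
  refine ⟨hlaw, fun a p => ?_⟩
  by_cases hp : p = 0
  · rw [hp, weight_zero]
    exact (hlaw.marginal a).le_one 0
  by_cases hE : ∃ E : Mal, E.kind = κ ∧ E.axis = a ∧ E.err = p
  · obtain ⟨E, hE⟩ := hE
    obtain ⟨hEκ, rfl, rfl⟩ := hE
    rw [← malProb_eq]
    refine (hmal E hEκ).trans ?_
    rw [weight, if_neg hp]
    refine le_trans (le_of_eq ?_) (Finset.single_le_sum (fun E' _ => ?_) (Finset.mem_univ E))
    · simp [hEκ]
    · split_ifs
      exacts [mul_nonneg (hα E').le ht, le_rfl]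
  · rw [marginal_exLaw]
    refine le_trans (le_of_eq ?_) (weight_nonneg hα ht a κ p)
    rw [div_eq_zero_iff]
    refine .inl (Finset.sum_eq_zero fun f _ => if_neg ?_)
    rintro ⟨-, hf⟩
    rcases canErr_logical κ v a (fun ℓ => f ℓ a) with h | h
    · exact hp (hf ▸ h)
    · exact hE (hf ▸ h)

theorem LevelBounded.exBounded {k : ℕ} (h : LevelBounded S α γ k t) {κ : Kind} {v : Variant}
    {ν : ExLoc S → Err → ℝ} (hν : ∀ ℓ, match kindAt κ v ℓ with
      | some κ' => ν ℓ ∈ level S γ k κ'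
      | none => ν ℓ = noErr) : ExBounded α t κ v ν := by
  intro ℓ
  have := hν ℓ
  cases hk : kindAt κ v ℓ <;> rw [hk] at this
  · exact this
  · exact h _ _ this

/-- The recursion step: a level-two bound at strength `t` becomes a strength for the next level,
since the counting uses nothing about a location beyond its being bounded. -/
theorem LevelBounded.succ (hα : ∀ E, 0 < α E) (ht : 0 ≤ t) (hA : AcceptPos cuts α t)
    {k : ℕ} (h : LevelBounded S α γ k t) {t' : ℝ} (ht' : 0 ≤ t')
    (hb : ∀ E, levelTwoBound cuts α E t ≤ α E * t') : LevelBounded S α γ (k + 1) t' := by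
  rintro κ μ ⟨v, ν, hν, rfl⟩
  have hex := h.exBounded hν
  refine isBounded_exLaw hα ht' (isLaw_exLaw hex.isLaw
    ((hA.acceptAll_pos _ _ _).trans_le (acceptAll_true_le hA hex))) ?_
  rintro E rfl
  exact (malProb_exLaw_le hα ht hA hex).trans (hb E)

theorem isLaw_of_level_zero (h0 : 0 ≤ γ) (h1 : γ < 1 / 15) {κ : Kind} {v : Variant}
    {ν : ExLoc S → Err → ℝ} (hν : ∀ ℓ, match kindAt κ v ℓ with
      | some κ' => ν ℓ ∈ level S γ 0 κ'
      | none => ν ℓ = noErr) (ℓ : ExLoc S) : IsLaw (ν ℓ) ∧ 0 < ν ℓ 0 := by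
  have := hν ℓ
  cases hk : kindAt κ v ℓ <;> rw [hk] at this
  · rw [show ν ℓ = noErr from this]
    exact ⟨isLaw_noErr, by simp [noErr]⟩
  · rw [show ν ℓ = _ from this]
    exact ⟨isLaw_depol h0 h1.le _, depol_zero_pos h1 _⟩

theorem cfgSum_pos {L β : Type} [Fintype L] [Fintype β] {w : L → β → ℝ} (hw : ∀ ℓ b, 0 ≤ w ℓ b)
    {A : (L → β) → Prop} {f : L → β} (hf : ∀ ℓ, 0 < w ℓ (f ℓ)) (hA : A f) : 0 < cfgSum w A := by
  refine Finset.sum_pos' (fun g _ => ?_) ⟨f, Finset.mem_univ _, ?_⟩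
  · split_ifs
    exacts [Finset.prod_nonneg fun ℓ _ => hw ℓ _, le_rfl]
  · rw [if_pos hA]
    exact Finset.prod_pos fun ℓ _ => hf ℓ

/-- No counting bound for acceptance is available for physical locations. That the conditioning is
meaningful follows from the failure-free configuration, of positive weight because `γ < 1 / 15`. -/
theorem isLaw_of_mem_level_one (h0 : 0 ≤ γ) (h1 : γ < 1 / 15) {κ : Kind} {μ : Err → ℝ}
    (hμ : μ ∈ level S γ 1 κ) : IsLaw μ := by
  obtain ⟨v, ν, hν, rfl⟩ := hμ
  have h := isLaw_of_level_zero h0 h1 hν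
  exact isLaw_exLaw (fun ℓ => (h ℓ).1) (cfgSum_pos (fun ℓ => (h ℓ).1.1) (fun ℓ => (h ℓ).2)
    (accepted_zero κ))

theorem level_one_nonempty (S : Scheme) (γ : ℝ) (κ : Kind) : (level S γ 1 κ).Nonempty := by
  refine ⟨_, fun _ => true, fun ℓ => match kindAt κ (fun _ => true) ℓ with
    | some κ' => depol γ κ'
    | none => noErr, fun ℓ => ?_, rfl⟩
  dsimp only
  cases kindAt κ (fun _ => true) ℓ <;> exact rfl

theorem levelBounded_one (h0 : 0 ≤ γ) (h1 : γ < 1 / 15) (hα : ∀ E, 0 < α E)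
    (h : ∀ E, ∀ μ ∈ level S γ 1 E.kind, malProb μ E ≤ α E * t) :
    0 ≤ t ∧ LevelBounded S α γ 1 t := by
  -- Nonnegativity of the strength is not assumed; it follows because it bounds, up to the positive
  -- `α`, an actual probability.
  have ht : 0 ≤ t := by
    obtain ⟨μ, hμ⟩ := level_one_nonempty S γ Mal.restX.kind
    have h2 : 0 ≤ malProb μ .restX :=
      malProb_eq μ .restX ▸ ((isLaw_of_mem_level_one h0 h1 hμ).marginal _).1 _
    exact nonneg_of_mul_nonneg_right (h2.trans (h _ _ hμ)) (hα _)
  refine ⟨ht, ?_⟩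
  intro κ μ hμ
  have hlaw := isLaw_of_mem_level_one h0 h1 hμ
  have hm : ∀ E : Mal, E.kind = κ → malProb μ E ≤ α E * t := fun E hE => h E μ (hE ▸ hμ)
  obtain ⟨v, ν, hν, rfl⟩ := hμ
  exact isBounded_exLaw hα ht hlaw hm

/-! ### Concatenation -/

theorem levelBounded_pow_two (hft : StrictlyFaultTolerant S) (hα : ∀ E, 0 < α E) {T x : ℝ}
    (hT : 0 ≤ T) (hx : 0 ≤ x) (hx1 : x ≤ 1) (hA : AcceptPos cuts α T)
    (hth : ∀ E, levelTwoBound cuts α E T ≤ α E * T) (h1 : LevelBounded S α γ 1 (x * T)) (k : ℕ) :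
    LevelBounded S α γ (k + 1) (x ^ 2 ^ k * T) := by
  induction k with
  | zero => simpa using h1
  | succ k ih =>
    have hy := pow_nonneg hx (2 ^ k)
    have hy1 := pow_le_one₀ (n := 2 ^ k) hx hx1
    refine ih.succ hα (mul_nonneg hy hT) (hA.mul hα hT hy hy1)
      (mul_nonneg (pow_nonneg hx _) hT) fun E => ?_
    calc _ ≤ (x ^ 2 ^ k) ^ 2 * levelTwoBound cuts α E T :=
          levelTwoBound_mul_le hft hα hT hy hy1 hA (by norm_num) cuts.two_le E
      _ ≤ (x ^ 2 ^ k) ^ 2 * (α E * T) := mul_le_mul_of_nonneg_left (hth E) (by positivity)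
      _ = α E * (x ^ 2 ^ (k + 1) * T) := by rw [pow_succ 2 k, pow_mul]; ring

theorem levelBounded_pow_four (hft : StrictlyFaultTolerant S) (hα : ∀ E, 0 < α E) {ε : ℝ}
    (ht : 0 ≤ t) (hε : 0 ≤ ε) (hε1 : ε ≤ 1) (hA : AcceptPos cuts α t)
    (h4 : ∀ κ v a, ∀ B ∈ cuts.exRec κ v a, 4 ≤ B.order)
    (hth : ∀ E, levelTwoBound cuts α E t ≤ ε * (α E * t)) (h1 : LevelBounded S α γ 1 t) (k : ℕ) :
    LevelBounded S α γ (k + 2) (ε ^ (4 * k + 1) * t) := by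
  induction k with
  | zero =>
    exact h1.succ hα ht hA (mul_nonneg (pow_nonneg hε _) ht) fun E =>
      (hth E).trans_eq (by ring)
  | succ k ih =>
    have hy := pow_nonneg hε (4 * k + 1)
    have hy1 := pow_le_one₀ (n := 4 * k + 1) hε hε1
    refine ih.succ hα (mul_nonneg hy ht) (hA.mul hα ht hy hy1)
      (mul_nonneg (pow_nonneg hε _) ht) fun E => ?_
    have hαt := mul_nonneg (hα E).le ht
    calc _ ≤ (ε ^ (4 * k + 1)) ^ 4 * levelTwoBound cuts α E t :=
          levelTwoBound_mul_le hft hα ht hy hy1 hA le_rfl h4 E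
      _ ≤ (ε ^ (4 * k + 1)) ^ 4 * (ε * (α E * t)) := mul_le_mul_of_nonneg_left (hth E) (by positivity)
      -- The exponent is `4 * (4 * k + 1) + 1`, more than the `4 * k + 5` that is claimed.
      _ = ε ^ (16 * k + 5) * (α E * t) := by rw [← pow_mul]; ring
      _ ≤ ε ^ (4 * (k + 1) + 1) * (α E * t) :=
          mul_le_mul_of_nonneg_right (pow_le_pow_of_le_one hε hε1 (by omega)) hαt
      _ = _ := by ring

/-- An event is determined by its kind, type and error, so the sum defining the weight has a single
nonzero term. -/
theorem LevelBounded.malProb_le_mul {k : ℕ} (h : LevelBounded S α γ k t) (E : Mal) {μ : Err → ℝ} (hμ : μ ∈ level S γ k E.kind) :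
    malProb μ E ≤ α E * t := by
  rw [malProb_eq]
  refine ((h _ _ hμ).2 _ _).trans_eq ?_
  rw [weight, if_neg E.err_ne_zero, Finset.sum_eq_single E]
  · simp
  · intro E' _ hE'
    refine if_neg ?_
    rintro ⟨h1, h2, h3⟩
    apply hE'
    cases E <;> cases E' <;> first | rfl | (revert h1 h2 h3; decide)
  · simp

/-- The total failure weight of a location for unit noise strength. -/
noncomputable def failWeight (α : Mal → ℝ) (κ : Kind) : ℝ :=
  ∑ a, ∑ p : Part, if p = 0 then 0 else weight α 1 a κ p

/-- A nontrivial error has a nontrivial `X` or `Z` part. The union bound over both types is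
insensitive to their correlation. -/
theorem IsBounded.one_sub_le {κ : Kind} {μ : Err → ℝ} (h : IsBounded α t κ μ) :
    1 - failWeight α κ * t ≤ μ 0 := by
  have h1 : ∑ e, (if e = 0 then 0 else μ e) ≤ ∑ a, ∑ p : Part, if p = 0 then 0 else marginal a μ p := by
    have h2 : ∀ a, (∑ p : Part, if p = 0 then 0 else marginal a μ p) =
        ∑ e : Err, if e a = 0 then 0 else μ e := fun a => by
      have : ∀ p : Part, (if p = 0 then 0 else marginal a μ p) =
          ∑ e : Err, if e a = p then (if e a = 0 then 0 else μ e) else 0 := fun p => by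
        by_cases hp : p = 0
        · rw [if_pos hp]
          refine (Finset.sum_eq_zero fun e _ => ?_).symm
          split_ifs <;> simp_all
        · rw [if_neg hp, marginal, mapLaw]
          refine Finset.sum_congr rfl fun e _ => ?_
          split_ifs <;> simp_all
      simp only [this]
      rw [Finset.sum_comm]
      simp
    simp only [h2]
    rw [Finset.sum_comm]
    refine Finset.sum_le_sum fun e _ => ?_
    have hnn : ∀ a ∈ Finset.univ, 0 ≤ (if e a = 0 then 0 else μ e) := fun a _ => by
      split_ifs
      exacts [le_rfl, h.1.1 e]
    split_ifs with he
    · exact Finset.sum_nonneg hnn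
    · obtain ⟨a, ha⟩ := Function.ne_iff.1 he
      refine le_trans (le_of_eq ?_) (Finset.single_le_sum hnn (Finset.mem_univ a))
      exact (if_neg ha).symm
  have h3 : ∑ a, ∑ p : Part, (if p = 0 then 0 else marginal a μ p) ≤ failWeight α κ * t := by
    rw [failWeight, Finset.sum_mul]
    refine Finset.sum_le_sum fun a _ => ?_
    rw [Finset.sum_mul]
    refine Finset.sum_le_sum fun p _ => ?_
    split_ifs with hp
    · simp
    · refine (h.2 a p).trans_eq ?_
      rw [mul_comm, ← weight_mul hp, mul_one]
  have h4 : μ 0 + ∑ e, (if e = 0 then 0 else μ e) = 1 := by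
    rw [← h.1.2, ← Finset.add_sum_erase _ _ (Finset.mem_univ (0 : Err)),
      ← Finset.add_sum_erase _ μ (Finset.mem_univ (0 : Err))]
    rw [if_pos rfl, zero_add]
    exact congrArg _ (Finset.sum_congr rfl fun e he => if_neg (Finset.ne_of_mem_erase he))
  linarith

theorem tolerable_of_levelBounded {u : ℕ → ℝ} (hu : Filter.Tendsto u Filter.atTop (nhds 0))
    (h : ∀ k, LevelBounded S α γ (k + 1) (u k)) : Tolerable S γ := by
  intro n C δ hδ
  have hsmall : ∀ i : Fin C.length, Filter.Tendsto
      (fun k => 1 - failWeight α (C.get i).kind * u k) Filter.atTop (nhds 1) := fun i => by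
    simpa using (hu.const_mul (failWeight α (C.get i).kind)).const_sub 1
  have hlim : Filter.Tendsto (fun k => ∏ i : Fin C.length, (1 - failWeight α (C.get i).kind * u k))
      Filter.atTop (nhds 1) := by
    simpa using tendsto_finsetProd Finset.univ fun i _ => hsmall i
  -- Besides the product being close to one, each factor must be positive for the products to be
  -- compared factor by factor.
  have hev := (hlim.eventually (lt_mem_nhds (sub_lt_self 1 hδ))).and
    (Filter.eventually_all.2 fun i => (hsmall i).eventually (lt_mem_nhds zero_lt_one))
  obtain ⟨k₀, hk₀⟩ := Filter.eventually_atTop.1 hev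
  refine ⟨k₀ + 1, fun k hk ν hν => ?_⟩
  obtain ⟨k, rfl⟩ : ∃ j, k = j + 1 := ⟨k - 1, by omega⟩
  obtain ⟨hs, hi⟩ := hk₀ k (by omega)
  rw [cfgSum_forall ν (fun _ e => e = 0)]
  refine hs.le.trans (Finset.prod_le_prod (fun i _ => (hi i).le) fun i _ => ?_)
  refine (h k _ _ (hν i)).one_sub_le.trans_eq ?_
  exact ((Finset.sum_eq_single 0 (fun e _ he => if_neg he)
    (fun h0 => absurd (Finset.mem_univ _) h0)).trans (if_pos rfl)).symm

end Levels

theorem tolerable_of_lt {S : Scheme} {cuts : Cutoffs S} {α : Mal → ℝ} {γ T x : ℝ}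
    (hft : StrictlyFaultTolerant S) (hα : ∀ E, 0 < α E) (hT : 0 ≤ T) (hx : 0 ≤ x) (hx1 : x < 1)
    (hA : AcceptPos cuts α T) (hth : ∀ E, levelTwoBound cuts α E T ≤ α E * T)
    (h1 : LevelBounded S α γ 1 (x * T)) : Tolerable S γ := by
  refine tolerable_of_levelBounded (u := fun k => x ^ 2 ^ k * T) ?_
    (levelBounded_pow_two hft hα hT hx hx1.le hA hth h1)
  have h := ((tendsto_pow_atTop_nhds_zero_of_lt_one hx hx1).comp
    (tendsto_pow_atTop_atTop_of_one_lt one_lt_two)).mul_const T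
  simpa using h

theorem four_mul_sub_three_le (k : ℕ) (hk : 1 ≤ k) : 4 * k - 3 ≤ 2 * (2 ^ k - 1) := by
  induction k, hk using Nat.le_induction with
  | base => norm_num
  | succ k hk ih =>
    have : 2 ^ 1 ≤ 2 ^ k := Nat.pow_le_pow_right (by norm_num) hk
    rw [pow_succ]
    omega

end GolayFT

/-! ### The threshold and the rates of convergence. -/

open GolayFT in
theorem mainTheorem2 (S : Scheme) (hS : ∀ i, (S i).Encodes) (hft : StrictlyFaultTolerant S)
    (cuts : Cutoffs S) (γmax : ℝ) (hγmax : γmax ≤ 1 / 15)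
    (P₁ : Mal → ℝ → ℝ) (Γ : ℝ → ℝ) (α : Mal → ℝ) (hα : ∀ E, 0 < α E)
    (hP₁ : ∀ γ ∈ Set.Icc 0 γmax, ∀ E, ∀ μ ∈ level S γ 1 E.kind, malProb μ E ≤ P₁ E γ)
    (hΓ : ∀ γ ∈ Set.Icc 0 γmax, ∀ E, P₁ E γ ≤ α E * Γ γ)
    (hmono : StrictMonoOn Γ (Set.Icc 0 γmax))
    (γth : ℝ) (hγth : γth ∈ Set.Icc 0 γmax)
    (hacc : AcceptPos cuts α (Γ γth))
    (hth : ∀ E, levelTwoBound cuts α E (Γ γth) ≤ α E * Γ γth) :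
    γth ≤ noiseThreshold S ∧
    (∀ γ, 0 ≤ γ → γ < γth → ∃ ε : ℝ, 0 < ε ∧ ε < 1 ∧ ∀ k : ℕ, 1 ≤ k → ∀ E : Mal,
      ∀ μ ∈ level S γ (k + 1) E.kind, malProb μ E ≤ ε ^ (4 * k - 3) * (α E * Γ γ)) ∧
    ((∀ κ v a, ∀ B ∈ cuts.exRec κ v a, 4 ≤ B.order) →
      ∀ γ, 0 ≤ γ → γ < γth → ∀ ε : ℝ, 0 ≤ ε → ε ≤ 1 →
        (∀ E, levelTwoBound cuts α E (Γ γ) ≤ ε * (α E * Γ γ)) →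
        ∀ k : ℕ, 1 ≤ k → ∀ E : Mal,
          ∀ μ ∈ level S γ (k + 1) E.kind, malProb μ E ≤ ε ^ (4 * k - 3) * (α E * Γ γ)) := by
  have hle : γth ≤ 1 / 15 := hγth.2.trans hγmax
  have hone : ∀ γ, 0 ≤ γ → γ < γth → 0 ≤ Γ γ ∧ LevelBounded S α γ 1 (Γ γ) := fun γ h0 h1 =>
    have hmem : γ ∈ Set.Icc 0 γmax := ⟨h0, h1.le.trans hγth.2⟩
    levelBounded_one h0 (h1.trans_le hle) hα fun E μ hμ =>
      (hP₁ γ hmem E μ hμ).trans (hΓ γ hmem E)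
  -- Strict monotonicity of `Γ` makes the ratio of strengths less than one, and `0 ≤ Γ γ` makes `Γ
  -- γth` positive.
  have hratio : ∀ γ, 0 ≤ γ → γ < γth →
      0 < Γ γth ∧ ∃ x : ℝ, 0 ≤ x ∧ x < 1 ∧ Γ γ = x * Γ γth := fun γ h0 h1 => by
    have hlt := hmono ⟨h0, h1.le.trans hγth.2⟩ hγth h1
    have h2 := (hone γ h0 h1).1
    have h3 := h2.trans_lt hlt
    exact ⟨h3, Γ γ / Γ γth, div_nonneg h2 h3.le, (div_lt_one h3).2 hlt,
      (div_mul_cancel₀ _ h3.ne').symm⟩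
  refine ⟨?_, ?_, ?_⟩
  · refine le_csSup ⟨1 / 15, fun g hg => hg.2.1⟩ ⟨hγth.1, hle, fun γ h0 h1 => ?_⟩
    obtain ⟨hT, x, hx, hx1, hxe⟩ := hratio γ h0 h1
    exact tolerable_of_lt hft hα hT.le hx hx1 hacc hth (hxe ▸ (hone γ h0 h1).2)
  · intro γ h0 h1
    obtain ⟨hT, x, hx, hx1, hxe⟩ := hratio γ h0 h1
    -- The square root ensures `x ≤ ε ^ 2`; the value `1 / 2` keeps `ε` positive when `x = 0`.
    have hε1 : max (Real.sqrt x) (1 / 2) < 1 :=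
      max_lt ((Real.sqrt_lt' one_pos).2 (by simpa using hx1)) (by norm_num)
    have hε0 : 0 < max (Real.sqrt x) (1 / 2) := lt_max_of_lt_right (by norm_num)
    have hxε : x ≤ max (Real.sqrt x) (1 / 2) ^ 2 := by
      calc x = Real.sqrt x ^ 2 := (Real.sq_sqrt hx).symm
        _ ≤ _ := pow_le_pow_left₀ (Real.sqrt_nonneg x) (le_max_left _ _) 2
    generalize max (Real.sqrt x) (1 / 2) = ε at hε0 hε1 hxε
    refine ⟨ε, hε0, hε1, fun k hk E μ hμ => ?_⟩
    have hb := levelBounded_pow_two hft hα hT.le hx hx1.le hacc hth (hxe ▸ (hone γ h0 h1).2) k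
    refine (hb.malProb_le_mul E hμ).trans ?_
    -- One factor `x` is set aside to turn `Γ γth` into `Γ γ`; the remaining `2 ^ k - 1` factors are
    -- each at most `ε ^ 2`.
    have hpow : x ^ 2 ^ k ≤ ε ^ (4 * k - 3) * x := by
      have h2k : 2 ^ k = (2 ^ k - 1) + 1 := (Nat.sub_add_cancel Nat.one_le_two_pow).symm
      rw [h2k, pow_succ]
      refine mul_le_mul_of_nonneg_right ?_ hx
      calc x ^ (2 ^ k - 1) ≤ (ε ^ 2) ^ (2 ^ k - 1) := pow_le_pow_left₀ hx hxε _
        _ = ε ^ (2 * (2 ^ k - 1)) := (pow_mul _ _ _).symm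
        _ ≤ ε ^ (4 * k - 3) :=
            pow_le_pow_of_le_one hε0.le hε1.le (four_mul_sub_three_le k hk)
    calc α E * (x ^ 2 ^ k * Γ γth) = x ^ 2 ^ k * (α E * Γ γth) := by ring
      _ ≤ ε ^ (4 * k - 3) * x * (α E * Γ γth) :=
          mul_le_mul_of_nonneg_right hpow (mul_nonneg (hα E).le hT.le)
      _ = _ := by rw [hxe]; ring
  · intro h4 γ h0 h1 ε hε hε1 hE k hk E μ hμ
    obtain ⟨hT, x, hx, hx1, hxe⟩ := hratio γ h0 h1
    obtain ⟨k, rfl⟩ : ∃ j, k = j + 1 := ⟨k - 1, by omega⟩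
    -- The recursion runs from `Γ γ` itself; positivity of the acceptance bounds there is inherited
    -- from `Γ γth` by scaling.
    have hb := levelBounded_pow_four hft hα (hone γ h0 h1).1 hε hε1
      (hxe ▸ hacc.mul hα hT.le hx hx1.le) h4 hE (hone γ h0 h1).2 k
    refine (hb.malProb_le_mul E hμ).trans_eq ?_
    rw [show 4 * (k + 1) - 3 = 4 * k + 1 by omega]
    ring
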